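/- **Theorem (Total error).** Let $d\in\mathbb N$, $\mathbb T^d=(\mathbb R/\mathbb Z)^d$, and write $\widehat f(h)=\int_{\mathbb T^d}f(x)e^{-2\pi i h\cdot x}\,dx$. For $\alpha>1/2$ let $E_\alpha(\mathbb T^d)$ be the Korobov space of all $f\in L_2(\mathbb T^d)$ with $\sum_{h\in\mathbb Z^d}|\widehat f(h)|^2\prod_{j=1}^d\max(|h_j|^{2\alpha},1)<\infty$; its elements are identified with their continuous representatives. Let $\gamma>0$, let $v\in E_\alpha(\mathbb T^d)$ be a real-valued potential with $\alpha\ge 9/2$, and let $g\in E_\beta(\mathbb T^d)$ with $\beta\ge2$. Let $u$ be the solution on $\mathbb T^d\times[0,T]$ of $$i\gamma\,\partial_t u=-\tfrac{\gamma^2}{2}\nabla^2u+v\,u,\qquad u(\cdot,0)=g,$$ with $u(\cdot,t)$ continuous on $\mathbb T^d$ for every $t$, $t\mapsto u(\cdot,t)$ continuous into $L_2$, and the equation understood weakly in space at each time. Let $Z=(z_1,\dots,z_r)\in\mathbb Z^{d\times r}$ and $\mathbf n=(n_1,\dots,n_r)\in\mathbb N^r$, $r\ge1$, be in canonical form: $n_{i+1}\mid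 n_i$, the $z_i$ are linearly independent over $\mathbb Q$, and the components of $z_i$ are jointly relatively prime to $n_i$. Put $n=\prod_i n_i$ and $p_k=\big(\sum_i z_ik_i/n_i\big)\bmod 1$ for $k\in G:=\prod_i\{0,\dots,n_i-1\}$. For $\xi\in G$ let $A(\xi)=\{h\in\mathbb Z^d: Z^\top h\equiv \xi \pmod{\mathbf n}\}$. Let $\mathcal A=\{h_\xi:\xi\in G\}$ with $h_\xi\in A(\xi)$ and $\|h_\xi\|_2=\min_{h'\in A(\xi)}\|h'\|_2$. Put $$\widehat f_a(h)=\frac1n\sum_{k\in G} f(p_k)e^{-2\pi i h\cdot p_k},\qquad \mathcal I_{\mathbf n}(f)(x)=\sum_{\xi\in G}\widehat f_a(h_\xi)e^{2\pi i h_\xi\cdot x}.$$ Let $F$ be the unitary $r$-dimensional discrete Fourier matrix on $\mathbb C^{G}$, with entries $\prod_{i}n_i^{-1/2}e^{-2\pi i k_i\xi_i/n_i}$, and let $D_{\mathbf n}=\mathrm{diag}(4\pi^2\|h_\xi\|_2^2)$, $V_{\mathbf n}=\mathrm{diag}(v(p_k))$, $W_{\mathbf n}=FV_{\mathbf n}F^{-1}$,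 $D=\frac\gamma2D_{\mathbf n}$. Let $\widehat{\boldsymbol u}_t\in\mathbb C^{G}$ solve $i\gamma\,\widehat{\boldsymbol u}_t'=\frac{\gamma^2}{2}D_{\mathbf n}\widehat{\boldsymbol u}_t+W_{\mathbf n}\widehat{\boldsymbol u}_t$ on $[0,T]$ with $\widehat{\boldsymbol u}_0=(\widehat g_a(h_\xi))_\xi$, and set $u_a(x,t)=\sum_\xi(\widehat{\boldsymbol u}_t)_\xi e^{2\pi i h_\xi\cdot x}$. For $\Delta t>0$ let $$\widehat{\boldsymbol u}_a^{0}=\widehat{\boldsymbol u}_0,\qquad \widehat{\boldsymbol u}_a^{k+1}=e^{-\frac{i}{2\gamma}W_{\mathbf n}\Delta t}\,e^{-\frac{i\gamma}{2}D_{\mathbf n}\Delta t}\,e^{-\frac{i}{2\gamma}W_{\mathbf n}\Delta t}\,\widehat{\boldsymbol u}_a^k,\qquad u_a^k(x)=\sum_\xi(\widehat{\boldsymbol u}^k_a)_\xi e^{2\pi i h_\xi\cdot x}.$$ Then there is a constant $C_2\ge0$, depending only on $d,\gamma,\alpha,v$ (in particular not on $Z$, $\mathbf n$, $n$, $k$,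 $\Delta t$, $t$, $g$), such that for all $k\ge0$ and $\Delta t>0$ with $t=k\Delta t\le T$ $$\begin{aligned}\|u(\cdot,t)-u_a^k\|_{L_2}&\le\|u(\cdot,t)-\mathcal I_{\mathbf n}(u)(\cdot,t)\|_{L_2}+\|\mathcal I_{\mathbf n}(u)(\cdot,t)-u_a(\cdot,t)\|_{L_2}+\|u_a(\cdot,t)-u_a^k\|_{L_2}\\&\le2\sum_{h\in\mathbb Z^d\setminus\mathcal A}|\widehat u(h,t)|+4\pi^2\,\frac{t\gamma}{2}\sup_{0\le t'\le t}\ \sum_{h\in\mathbb Z^d\setminus\mathcal A}\|h\|_2^2\,|\widehat u(h,t')|\\&\qquad+(\Delta t)^2\,C_2\,t\max_{0\le t'\le t}\|(D+I)^2\widehat{\boldsymbol u}_{t'}\|_2,\end{aligned}$$ where the two sums over $h$ and the supremum take values in $[0,\infty]$, and $0\cdot\infty=0$. -/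

import Mathlib

open scoped ENNReal

noncomputable section

namespace TDSE

/-! ### The torus, frequencies and Korobov spaces -/

/-- The `d`-dimensional torus `𝕋^d = (ℝ/ℤ)^d`. -/
abbrev Torus (d : ℕ) : Type := UnitAddTorus (Fin d)

/-- The Lebesgue (normalised Haar) measure on `𝕋^d`, of total mass one. -/
abbrev torusMeasure (d : ℕ) : MeasureTheory.Measure (Torus d) :=
  MeasureTheory.Measure.pi (fun _ : Fin d => AddCircle.haarAddCircle)

/-- The Fourier coefficient `f̂(h) = ∫ f(x) exp(-2πi h·x) dx`. -/
def torusFourierCoeff {d : ℕ} (f : Torus d → ℂ) (h : Fin d → ℤ) : ℂ :=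
  ∫ x, f x * UnitAddTorus.mFourier (-h) x ∂(torusMeasure d)

/-- The Euclidean norm `‖h‖₂` of a frequency `h ∈ ℤ^d`. -/
def freqNorm {d : ℕ} (h : Fin d → ℤ) : ℝ := √(∑ j, (h j : ℝ) ^ 2)

/-- The squared Korobov weight `r_α²(h) = ∏_j max(|h_j|^{2α}, 1)`. -/
def korobovWeightSq {d : ℕ} (α : ℝ) (h : Fin d → ℤ) : ℝ :=
  ∏ j, max (|(h j : ℝ)| ^ (2 * α)) 1

/-- Membership in the Korobov space `E_α(𝕋^d)`. -/
def IsKorobov {d : ℕ} (α : ℝ) (f : Torus d → ℂ) : Prop :=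
  MeasureTheory.MemLp f 2 (torusMeasure d) ∧
    Summable (fun h : Fin d → ℤ => ‖torusFourierCoeff f h‖ ^ 2 * korobovWeightSq α h)

/-! ### The time-dependent Schrödinger equation -/

/-- A function on the torus as a `ℤ^d`-periodic function on `ℝ^d`. -/
def periodicLift {d : ℕ} (f : Torus d → ℂ) : EuclideanSpace ℝ (Fin d) → ℂ :=
  fun x => f (fun j => ((x j : ℝ) : UnitAddCircle))

/-- The representative in `[0,1)^d` of a point of the torus. -/
def representative {d : ℕ} (x : Torus d) : EuclideanSpace ℝ (Fin d) :=
  WithLp.toLp 2 (fun j => (AddCircle.equivIco (1 : ℝ) 0 (x j) : ℝ))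

/-- The Laplacian `∇²φ` of a function on the torus. -/
def torusLaplacian {d : ℕ} (φ : Torus d → ℂ) : Torus d → ℂ :=
  fun x => Laplacian.laplacian (periodicLift φ) (representative x)

/-- `φ ∈ C^∞(𝕋^d)`. -/
def IsSmooth {d : ℕ} (φ : Torus d → ℂ) : Prop :=
  ContDiff ℝ ((⊤ : ℕ∞) : WithTop ℕ∞) (periodicLift φ)

/-- `u` solves `i γ ∂u/∂t = -(γ²/2) ∇²u + v u` on `𝕋^d × [0,T]` with `u(·,0) = g`, in the weak sense:
`u(·,t)` is a continuous function on the torus for each `t`, the map `t ↦ u(·,t)` is continuous into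
`L₂` on `[0,T]`, and the equation holds at every time `t ∈ [0,T]` when it is tested in space
with an arbitrary smooth function on the torus (one-sided time derivatives at the endpoints). -/
structure IsSolution {d : ℕ} (γ T : ℝ) (v : C(Torus d, ℝ)) (g : C(Torus d, ℂ))
    (u : ℝ → C(Torus d, ℂ)) : Prop where
  initial : u 0 = g
  continuousOn : ContinuousOn
    (fun t => ContinuousMap.toLp (E := ℂ) 2 (torusMeasure d) ℂ (u t)) (Set.Icc 0 T)
  equation : ∀ φ : C(Torus d, ℂ), IsSmooth φ → ∀ t ∈ Set.Icc (0 : ℝ) T,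
    HasDerivWithinAt (fun s => Complex.I * γ * ∫ x, u s x * φ x ∂(torusMeasure d))
      (-((γ : ℂ) ^ 2 / 2) * (∫ x, u t x * torusLaplacian φ x ∂(torusMeasure d))
        + ∫ x, (v x : ℂ) * u t x * φ x ∂(torusMeasure d))
      (Set.Icc 0 T) t

/-! ### Rank-`r` lattices and anti-aliasing sets -/

/-- Multi-indices `ξ ∈ ℤ_{n₁} ⊕ ⋯ ⊕ ℤ_{n_r}`, each component represented in `{0,…,n_i - 1}`. -/
abbrev MultiIndex {r : ℕ} (n : Fin r → ℕ) : Type := (i : Fin r) → Fin (n i)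

/-- The generating vectors (the columns of `Z`) and the moduli `n` are in canonical form:
`r ≥ 1`, the moduli are positive with `n_{i+1} ∣ n_i`, the generating vectors are linearly
independent over `ℚ`, and the components of `z_i` are (jointly) relatively prime to `n_i`. -/
structure IsCanonical {d r : ℕ} (Z : Matrix (Fin d) (Fin r) ℤ) (n : Fin r → ℕ) : Prop where
  rank_pos : 0 < r
  moduli_pos : ∀ i, 0 < n i
  dvd : ∀ i j : Fin r, (j : ℕ) = (i : ℕ) + 1 → n j ∣ n i
  linearIndependent : LinearIndependent ℚ (fun (i : Fin r) (j : Fin d) => (Z j i : ℚ))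
  coprime : ∀ i, Nat.Coprime (Finset.univ.gcd fun j => (Z j i).natAbs) (n i)

/-- The lattice point `p_k = (z₁ k₁ / n₁ + ⋯ + z_r k_r / n_r) mod 1`. -/
def latticePoint {d r : ℕ} (Z : Matrix (Fin d) (Fin r) ℤ) (n : Fin r → ℕ) (k : MultiIndex n) :
    Torus d :=
  fun j => ((∑ i, (Z j i : ℝ) * ((k i : ℕ) : ℝ) / (n i : ℝ) : ℝ) : UnitAddCircle)

/-- The residue class `A(Z, n, ξ) = {h ∈ ℤ^d : Zᵀ h ≡ ξ (mod n)}`. -/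
def residueClass {d r : ℕ} (Z : Matrix (Fin d) (Fin r) ℤ) (n : Fin r → ℕ) (ξ : MultiIndex n) :
    Set (Fin d → ℤ) :=
  {h | ∀ i, (Z.transpose.mulVec h) i ≡ ((ξ i : ℕ) : ℤ) [ZMOD (n i : ℤ)]}

/-- The family `(h_ξ)_ξ` enumerates an anti-aliasing set of full cardinality, each `h_ξ` having
minimal Euclidean norm in its residue class. The anti-aliasing set itself is `Set.range h`. -/
structure IsMinimalAntiAliasing {d r : ℕ} (Z : Matrix (Fin d) (Fin r) ℤ) (n : Fin r → ℕ)
    (h : MultiIndex n → Fin d → ℤ) : Prop where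
  mem : ∀ ξ, h ξ ∈ residueClass Z n ξ
  minimal : ∀ ξ, ∀ h' ∈ residueClass Z n ξ, freqNorm (h ξ) ≤ freqNorm h'

/-! ### Spatial discretization -/

/-- The Fourier coefficient computed by the lattice rule,
`f̂_a(h) = (1 / (n₁ ⋯ n_r)) ∑_k f(p_k) exp(-2πi h·p_k)`. -/
def latticeCoeff {d r : ℕ} (Z : Matrix (Fin d) (Fin r) ℤ) (n : Fin r → ℕ) (f : Torus d → ℂ)
    (h : Fin d → ℤ) : ℂ :=
  (1 / ((∏ i, n i : ℕ) : ℂ)) *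
    ∑ k : MultiIndex n, f (latticePoint Z n k) * UnitAddTorus.mFourier (-h) (latticePoint Z n k)

/-- The vector `(f̂_a(h_ξ))_ξ`. -/
def latticeCoeffVec {d r : ℕ} (Z : Matrix (Fin d) (Fin r) ℤ) (n : Fin r → ℕ)
    (h : MultiIndex n → Fin d → ℤ) (f : Torus d → ℂ) : MultiIndex n → ℂ :=
  fun ξ => latticeCoeff Z n f (h ξ)

/-- The trigonometric polynomial `x ↦ ∑_ξ c_ξ exp(2πi h_ξ·x)`. -/
def trigPoly {d r : ℕ} {n : Fin r → ℕ} (h : MultiIndex n → Fin d → ℤ) (c : MultiIndex n → ℂ) :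
    C(Torus d, ℂ) :=
  ∑ ξ, c ξ • UnitAddTorus.mFourier (h ξ)

/-- The interpolation operator on the lattice points. -/
def interp {d r : ℕ} (Z : Matrix (Fin d) (Fin r) ℤ) (n : Fin r → ℕ)
    (h : MultiIndex n → Fin d → ℤ) (f : Torus d → ℂ) : C(Torus d, ℂ) :=
  trigPoly h (latticeCoeffVec Z n h f)

/-- The unitary `r`-dimensional discrete Fourier matrix, the tensor product of the matrices
`n_i^{-1/2} (exp(-2πi k ξ / n_i))`. -/
def dftMatrix {r : ℕ} (n : Fin r → ℕ) : Matrix (MultiIndex n) (MultiIndex n) ℂ :=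
  Matrix.of fun ξ k => ∏ i, (1 / ((√(n i : ℝ) : ℝ) : ℂ)) *
    Complex.exp (-(2 * Real.pi * Complex.I) * ((k i : ℕ) : ℂ) * ((ξ i : ℕ) : ℂ) / (n i : ℂ))

/-- The diagonal matrix with entries `4π² ‖h_ξ‖₂²`. -/
def laplaceMatrix {d r : ℕ} {n : Fin r → ℕ} (h : MultiIndex n → Fin d → ℤ) :
    Matrix (MultiIndex n) (MultiIndex n) ℂ :=
  Matrix.diagonal fun ξ => ((4 * Real.pi ^ 2 * freqNorm (h ξ) ^ 2 : ℝ) : ℂ)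

/-- The diagonal matrix with entries `v(p_k)`. -/
def potentialMatrix {d r : ℕ} (Z : Matrix (Fin d) (Fin r) ℤ) (n : Fin r → ℕ)
    (v : C(Torus d, ℝ)) : Matrix (MultiIndex n) (MultiIndex n) ℂ :=
  Matrix.diagonal fun k => ((v (latticePoint Z n k) : ℝ) : ℂ)

/-- The matrix `F V F⁻¹`: multiplication by `v` in the discrete Fourier domain. -/
def multMatrix {d r : ℕ} (Z : Matrix (Fin d) (Fin r) ℤ) (n : Fin r → ℕ)
    (v : C(Torus d, ℝ)) : Matrix (MultiIndex n) (MultiIndex n) ℂ :=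
  dftMatrix n * potentialMatrix Z n v * (dftMatrix n)⁻¹

/-- The vector `U t` of coefficients of the spatially discretized solution: it solves the system
`i γ U' = (γ²/2) D_n U + W_n U` on `[0,T]` with `U(0) = ĝ_a`. -/
structure IsSemidiscreteSolution {d r : ℕ} (γ T : ℝ) (Z : Matrix (Fin d) (Fin r) ℤ)
    (n : Fin r → ℕ) (h : MultiIndex n → Fin d → ℤ) (v : C(Torus d, ℝ)) (g : C(Torus d, ℂ))
    (U : ℝ → MultiIndex n → ℂ) : Prop where
  initial : U 0 = latticeCoeffVec Z n h g
  equation : ∀ t ∈ Set.Icc (0 : ℝ) T,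
    HasDerivWithinAt (fun s => (Complex.I * (γ : ℂ)) • U s)
      (((γ : ℂ) ^ 2 / 2) • (laplaceMatrix h).mulVec (U t) + (multMatrix Z n v).mulVec (U t))
      (Set.Icc 0 T) t

/-! ### Strang splitting -/

/-- One Strang step,
`exp(-(i/(2γ)) W_n Δt) exp(-(iγ/2) D_n Δt) exp(-(i/(2γ)) W_n Δt)`. -/
def strangStep {d r : ℕ} (γ τ : ℝ) (Z : Matrix (Fin d) (Fin r) ℤ) (n : Fin r → ℕ)
    (h : MultiIndex n → Fin d → ℤ) (v : C(Torus d, ℝ)) :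
    Matrix (MultiIndex n) (MultiIndex n) ℂ :=
  NormedSpace.exp ((-(Complex.I / (2 * (γ : ℂ))) * (τ : ℂ)) • multMatrix Z n v) *
    NormedSpace.exp ((-(Complex.I * (γ : ℂ) / 2) * (τ : ℂ)) • laplaceMatrix h) *
    NormedSpace.exp ((-(Complex.I / (2 * (γ : ℂ))) * (τ : ℂ)) • multMatrix Z n v)

/-- The coefficient vector after `k` Strang steps of length `τ`, started from `ĝ_a`. -/
def strangIterate {d r : ℕ} (γ τ : ℝ) (Z : Matrix (Fin d) (Fin r) ℤ) (n : Fin r → ℕ)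
    (h : MultiIndex n → Fin d → ℤ) (v : C(Torus d, ℝ)) (g : C(Torus d, ℂ)) :
    ℕ → MultiIndex n → ℂ
  | 0 => latticeCoeffVec Z n h g
  | k + 1 => (strangStep γ τ Z n h v).mulVec (strangIterate γ τ Z n h v g k)

/-! ### Norms and tails in the error bound, with values in `[0,∞]` -/

/-- The `L₂(𝕋^d)` norm. -/
def normL2 {d : ℕ} (f : Torus d → ℂ) : ℝ≥0∞ := MeasureTheory.eLpNorm f 2 (torusMeasure d)

/-- `∑_{h ∈ ℤ^d ∖ S} |f̂(h)|`. -/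
def tailSum {d : ℕ} (S : Set (Fin d → ℤ)) (f : Torus d → ℂ) : ℝ≥0∞ :=
  ∑' h : (Sᶜ : Set (Fin d → ℤ)), ENNReal.ofReal ‖torusFourierCoeff f h‖

/-- `∑_{h ∈ ℤ^d ∖ S} ‖h‖₂² |f̂(h)|`. -/
def weightedTailSum {d : ℕ} (S : Set (Fin d → ℤ)) (f : Torus d → ℂ) : ℝ≥0∞ :=
  ∑' h : (Sᶜ : Set (Fin d → ℤ)),
    ENNReal.ofReal (freqNorm (h : Fin d → ℤ) ^ 2 * ‖torusFourierCoeff f h‖)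

/-- `‖(D + I)² c‖₂` with `D = (γ/2) D_n`. -/
def graphNorm {d r : ℕ} {n : Fin r → ℕ} (γ : ℝ) (h : MultiIndex n → Fin d → ℤ)
    (c : MultiIndex n → ℂ) : ℝ :=
  ‖(WithLp.toLp 2 (((((γ : ℂ) / 2) • laplaceMatrix h + 1) ^ 2).mulVec c) :
    EuclideanSpace ℂ (MultiIndex n))‖

end TDSE

end

/-!
The total error splits into an interpolation error, an aliasing error and a time-stepping error.

*Interpolation.* The lattice rule sends the exponential of frequency `l` to the one of frequency
`h_ξ`, where `ξ` is the residue of `l`. Hence `f - I_n f` is the sum over `l` of `f̂(l)` times the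
difference of two exponentials, which vanishes for `l` in the anti-aliasing set and has norm at
most `2` otherwise (`IsMinimalAntiAliasing.normL2_sub_interp_le`).

*Aliasing.* The samples of `u` in the discrete Fourier domain solve the semidiscrete equation up to
a forcing: multiplication by `v` commutes exactly with sampling, so only the difference between
`‖l‖₂²` and `‖h_ξ‖₂²` for the frequencies `l` outside the anti-aliasing set remains, and it lies
between `0` and `‖l‖₂²` by minimality. The semidiscrete Hamiltonian is self-adjoint, so Duhamel's
formula bounds the error by the time integral of the forcing (`norm_sample_sub_le`).

*Time stepping.* For self-adjoint `A` and `B` the defect of the Strang propagator vanishes to second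
order in the step, with remainder given by the double commutators `[A, [A, B]]` and `[B, [A, B]]`.
These are bounded by `(A + 1)²` as soon as `B` is bounded in the graph norms of `1`, `A + 1` and
`(A + 1)²` (`IsSplitting`). Unitarity adds up the local errors
(`IsSplitting.norm_sub_strangFlow_pow_le`).

What remains is to bound `W_n / γ` in these norms uniformly in the lattice
(`isSplitting_kineticOp_potentialOp`). Now `W_n` is the superposition, with weights `v̂(l)`, of
permutations `ξ ↦ ξ'` of the index set, and minimality gives `‖h_ξ‖₂ ≤ ‖h_ξ'‖₂ + ‖l‖₂`. In the norm
of order four, the frequencies with `‖l‖₂ < ‖h_ξ‖₂ / 2` only need `∑ |v̂(l)| < ∞`. For the others,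
`‖l‖₂⁴ |v̂(l)|` need not be summable when `α = 9/2`, so a triangle inequality does not suffice. The
Cauchy-Schwarz inequality with the weight `‖l‖₂⁷ / r_α²(l)` does: the tail of this weight beyond the
radius `X` is of order `1 / X`, and the resulting power of `‖h_ξ‖₂` cancels exactly
(`norm_sum_large_le`).
-/

namespace TDSE

open NormedSpace

/-! ### Exponentials of operators -/

lemma hasDerivAt_exp_conj {𝔸 : Type*} [NormedRing 𝔸] [NormedAlgebra ℝ 𝔸] [CompleteSpace 𝔸]
    (C X : 𝔸) (s : ℝ) :
    HasDerivAt (fun s : ℝ => exp (s • C) * X * exp (s • -C))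
      (exp (s • C) * (C * X - X * C) * exp (s • -C)) s := by
  have h1 := hasDerivAt_exp_smul_const (𝕂 := ℝ) C s
  have h2 := hasDerivAt_exp_smul_const' (𝕂 := ℝ) (-C) s
  refine ((h1.mul_const X).mul h2).congr_deriv ?_
  noncomm_ring

lemma exp_mul_exp_neg {𝔸 : Type*} [NormedRing 𝔸] [NormedAlgebra ℝ 𝔸] [CompleteSpace 𝔸]
    (C : 𝔸) : exp C * exp (-C) = 1 := by
  let := NormedAlgebra.restrictScalars ℚ ℝ 𝔸
  rw [← exp_add_of_commute (Commute.refl C).neg_right, add_neg_cancel, exp_zero]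

lemma hasDerivWithinAt_apply {E : Type*} [NormedAddCommGroup E] [NormedSpace ℂ E]
    {c : ℝ → E →L[ℂ] E} {c' : E →L[ℂ] E} {u : ℝ → E} {u' : E} {s : Set ℝ} {x : ℝ}
    (hc : HasDerivWithinAt c c' s x) (hu : HasDerivWithinAt u u' s x) :
    HasDerivWithinAt (fun y => c y (u y)) (c' (u x) + c x u') s x :=
  ((ContinuousLinearMap.restrictScalarsL ℂ E E ℝ ℝ).hasFDerivAt.comp_hasDerivWithinAt x
    hc).clm_apply hu

lemma exp_mem_unitary_of_skewAdjoint {𝔸 : Type*} [NormedRing 𝔸] [NormedAlgebra ℝ 𝔸]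
    [CompleteSpace 𝔸] [StarRing 𝔸] [ContinuousStar 𝔸] {x : 𝔸} (h : x ∈ skewAdjoint 𝔸) :
    exp x ∈ unitary 𝔸 := by
  let := NormedAlgebra.restrictScalars ℚ ℝ 𝔸
  exact exp_mem_unitary_of_mem_skewAdjoint h

section Hilbert

variable {E : Type*} [NormedAddCommGroup E] [InnerProductSpace ℂ E] [CompleteSpace E]

/-- The operator `(A + 1)²`. -/
noncomputable abbrev shiftSq (A : E →L[ℂ] E) : E →L[ℂ] E := (A + 1) ^ 2

/-- The Strang propagator `e^{-isB/2} e^{-isA} e^{-isB/2}`. -/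
noncomputable def strangFlow (A B : E →L[ℂ] E) (s : ℝ) : E →L[ℂ] E :=
  exp (s • (-(Complex.I / 2) • B)) * exp (s • (-Complex.I • A)) * exp (s • (-(Complex.I / 2) • B))

lemma smul_mem_skewAdjoint {A : E →L[ℂ] E} (hA : IsSelfAdjoint A) {c : ℂ}
    (hc : star c = -c) (s : ℝ) : s • (c • A) ∈ skewAdjoint (E →L[ℂ] E) := by
  have e : s • c • A = ((s : ℂ) * c) • A := by rw [mul_smul]; rfl
  rw [skewAdjoint.mem_iff, e, star_smul, hA.star_eq, star_mul, hc]
  simp [mul_comm]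

lemma norm_exp_apply_of_skewAdjoint {C : E →L[ℂ] E} (h : C ∈ skewAdjoint (E →L[ℂ] E)) (x : E) :
    ‖exp C x‖ = ‖x‖ := by
  have := exp_mem_unitary_of_skewAdjoint h
  exact ContinuousLinearMap.norm_map_of_mem_unitary this x

lemma norm_exp_smul_skew_apply {A : E →L[ℂ] E} (hA : IsSelfAdjoint A) {c : ℂ}
    (hc : star c = -c) (s : ℝ) (x : E) : ‖exp (s • (c • A)) x‖ = ‖x‖ :=
  norm_exp_apply_of_skewAdjoint (smul_mem_skewAdjoint hA hc s) x

/-- If `‖L C x‖ ≤ b ‖L x‖` for all `x`, the flow of `C` grows at most like `e^{bs}` when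
measured by `‖L ·‖`. -/
lemma norm_exp_smul_apply_le (L C : E →L[ℂ] E) {b : ℝ}
    (h : ∀ x, ‖L (C x)‖ ≤ b * ‖L x‖) {s : ℝ} (hs : 0 ≤ s) (x : E) :
    ‖L (exp (s • C) x)‖ ≤ Real.exp (b * s) * ‖L x‖ := by
  have hd : ∀ r : ℝ, HasDerivAt (fun r : ℝ => L (exp (r • C) x)) (L (C (exp (r • C) x))) r := by
    intro r
    have h1 := hasDerivWithinAt_apply
      (hasDerivAt_exp_smul_const' (𝕂 := ℝ) C r).hasDerivWithinAt
      (hasDerivAt_const r x).hasDerivWithinAt (s := Set.univ)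
    have h2 := (L.restrictScalars ℝ).hasFDerivAt.comp_hasDerivAt r (hasDerivWithinAt_univ.1 h1)
    simpa [Function.comp_def] using h2
  have := norm_le_gronwallBound_of_norm_deriv_right_le (f := fun r : ℝ => L (exp (r • C) x))
    (f' := fun r => L (C (exp (r • C) x))) (δ := ‖L x‖) (K := b) (ε := 0) (a := 0) (b := s)
    (fun r _ => (hd r).continuousAt.continuousWithinAt)
    (fun r _ => (hd r).hasDerivWithinAt) (by simp) (fun r _ => by simpa using h _) s
    ⟨hs, le_rfl⟩
  rw [gronwallBound_ε0] at this
  simpa [mul_comm] using this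

/-- Duhamel's estimate: a solution of `e' = -iHe + f` with `H` self-adjoint moves away from zero
no faster than the forcing allows. -/
lemma norm_le_add_integral_of_hasDerivWithinAt {H : E →L[ℂ] E} (hH : IsSelfAdjoint H)
    {e f : ℝ → E} {t : ℝ} (ht : 0 ≤ t)
    (he : ∀ s ∈ Set.Icc 0 t, HasDerivWithinAt e (-Complex.I • H (e s) + f s) (Set.Icc 0 t) s)
    (hf : ContinuousOn f (Set.Icc 0 t)) :
    ‖e t‖ ≤ ‖e 0‖ + ∫ s in (0 : ℝ)..t, ‖f s‖ := by
  set P : ℝ → E →L[ℂ] E := fun s => exp (s • (Complex.I • H)) with hP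
  have hPn : ∀ s x, ‖P s x‖ = ‖x‖ := fun s x => norm_exp_smul_skew_apply hH (by simp) s x
  have hPd : ∀ s, HasDerivAt P (P s * (Complex.I • H)) s := fun s =>
    hasDerivAt_exp_smul_const (𝕂 := ℝ) (Complex.I • H) s
  have hPc : Continuous P := continuous_iff_continuousAt.2 fun s => (hPd s).continuousAt
  have hd : ∀ s ∈ Set.Icc 0 t,
      HasDerivWithinAt (fun s => P s (e s)) (P s (f s)) (Set.Icc 0 t) s := by
    intro s hs
    refine (hasDerivWithinAt_apply (hPd s).hasDerivWithinAt (he s hs)).congr_deriv ?_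
    simp
  have hc : ContinuousOn (fun s => P s (f s)) (Set.Icc 0 t) := hPc.continuousOn.clm_apply hf
  have hi : IntervalIntegrable (fun s => P s (f s)) MeasureTheory.volume 0 t :=
    ContinuousOn.intervalIntegrable (by rwa [Set.uIcc_of_le ht])
  have key := intervalIntegral.integral_eq_sub_of_hasDeriv_right_of_le ht
    (f := fun s => P s (e s)) (f' := fun s => P s (f s))
    (fun s hs => (hd s hs).continuousWithinAt)
    (fun s hs => ((hd s (Set.Ioo_subset_Icc_self hs)).hasDerivAt
      (Icc_mem_nhds hs.1 hs.2)).hasDerivWithinAt) hi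
  have h0 : P 0 (e 0) = e 0 := by simp [hP]
  rw [h0] at key
  calc ‖e t‖ = ‖P t (e t)‖ := (hPn _ _).symm
    _ = ‖e 0 + ∫ s in (0 : ℝ)..t, P s (f s)‖ := by rw [key]; congr 1; abel
    _ ≤ ‖e 0‖ + ‖∫ s in (0 : ℝ)..t, P s (f s)‖ := norm_add_le _ _
    _ ≤ ‖e 0‖ + ∫ s in (0 : ℝ)..t, ‖P s (f s)‖ := by
        gcongr; exact intervalIntegral.norm_integral_le_integral_norm ht
    _ = _ := by simp only [hPn]

/-! ### Strang splitting of an abstract Hamiltonian -/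

/-- The hypotheses on a Hamiltonian `A + B` under which Strang splitting is of second order on
the domain of `(A + 1)²`: `A` dominates the identity after a shift by `1`, and `B` is bounded by
`b` in each of the norms `‖x‖`, `‖(A + 1) x‖`, `‖(A + 1)² x‖`. -/
structure IsSplitting (A B : E →L[ℂ] E) (b : ℝ) : Prop where
  selfAdjoint_left : IsSelfAdjoint A
  selfAdjoint_right : IsSelfAdjoint B
  nonneg : 0 ≤ b
  norm_le : ∀ x, ‖x‖ ≤ ‖(A + 1) x‖
  norm_apply_le : ∀ x, ‖A x‖ ≤ ‖(A + 1) x‖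
  bound_zero : ∀ x, ‖B x‖ ≤ b * ‖x‖
  bound_one : ∀ x, ‖(A + 1) (B x)‖ ≤ b * ‖(A + 1) x‖
  bound_two : ∀ x, ‖shiftSq A (B x)‖ ≤ b * ‖shiftSq A x‖

namespace IsSplitting

variable {A B : E →L[ℂ] E} {b : ℝ}

lemma norm_le_sq (h : IsSplitting A B b) (x : E) : ‖(A + 1) x‖ ≤ ‖shiftSq A x‖ := by
  rw [shiftSq, pow_two]; exact h.norm_le _

lemma norm_add_one_apply_le (h : IsSplitting A B b) (x : E) :
    ‖(A + 1) (A x)‖ ≤ ‖shiftSq A x‖ := by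
  have : (A + 1) (A x) = A ((A + 1) x) := by simp
  rw [this, shiftSq, pow_two]; exact h.norm_apply_le _

/-- The double commutator `[A, [A, B]]` is bounded relative to `(A + 1)²`. -/
lemma norm_commutator_left_le (h : IsSplitting A B b) (x : E) :
    ‖(A * (A * B - B * A) - (A * B - B * A) * A) x‖ ≤ 4 * b * ‖shiftSq A x‖ := by
  have hb := h.nonneg
  have e : (A * (A * B - B * A) - (A * B - B * A) * A) x
      = A (A (B x)) - (2 : ℝ) • A (B (A x)) + B (A (A x)) := by
    simp [two_smul]; abel
  have h1 : ‖A (A (B x))‖ ≤ b * ‖shiftSq A x‖ :=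
    (h.norm_apply_le _).trans ((h.norm_add_one_apply_le _).trans (h.bound_two x))
  have h2 : ‖A (B (A x))‖ ≤ b * ‖shiftSq A x‖ :=
    (h.norm_apply_le _).trans ((h.bound_one _).trans (by
      gcongr; exact h.norm_add_one_apply_le x))
  have h3 : ‖B (A (A x))‖ ≤ b * ‖shiftSq A x‖ :=
    (h.bound_zero _).trans (by
      gcongr; exact (h.norm_apply_le _).trans (h.norm_add_one_apply_le x))
  rw [e]
  refine (norm_add_le _ _).trans ?_
  have h4 := norm_sub_le (A (A (B x))) ((2 : ℝ) • A (B (A x)))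
  rw [norm_smul, Real.norm_ofNat] at h4
  linarith

/-- The double commutator `[B, [A, B]]` is bounded relative to `(A + 1)²`. -/
lemma norm_commutator_right_le (h : IsSplitting A B b) (x : E) :
    ‖(B * (A * B - B * A) - (A * B - B * A) * B) x‖ ≤ 4 * b ^ 2 * ‖shiftSq A x‖ := by
  have hb := h.nonneg
  have e : (B * (A * B - B * A) - (A * B - B * A) * B) x
      = (2 : ℝ) • B (A (B x)) - B (B (A x)) - A (B (B x)) := by
    simp [two_smul]; abel
  have h0 : ∀ y, ‖A y‖ ≤ ‖shiftSq A y‖ := fun y => (h.norm_apply_le y).trans (h.norm_le_sq y)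
  have h1 : ‖B (A (B x))‖ ≤ b ^ 2 * ‖shiftSq A x‖ := by
    refine (h.bound_zero _).trans ?_
    rw [pow_two, mul_assoc]
    gcongr
    exact (h0 _).trans (h.bound_two x)
  have h2 : ‖B (B (A x))‖ ≤ b ^ 2 * ‖shiftSq A x‖ := by
    refine (h.bound_zero _).trans ?_
    rw [pow_two, mul_assoc]
    gcongr
    exact (h.bound_zero _).trans (by gcongr; exact h0 x)
  have h3 : ‖A (B (B x))‖ ≤ b ^ 2 * ‖shiftSq A x‖ := by
    refine (h0 _).trans ((h.bound_two _).trans ?_)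
    rw [pow_two b, mul_assoc]
    gcongr
    exact h.bound_two x
  rw [e]
  have h4 := norm_sub_le ((2 : ℝ) • B (A (B x)) - B (B (A x))) (A (B (B x)))
  have h5 := norm_sub_le ((2 : ℝ) • B (A (B x))) (B (B (A x)))
  rw [norm_smul, Real.norm_ofNat] at h5
  linarith

lemma norm_exp_right_le (h : IsSplitting A B b) {c : ℂ} (hc : ‖c‖ = 1 / 2) {s : ℝ} (hs : 0 ≤ s)
    (hs1 : s ≤ 1) (x : E) :
    ‖shiftSq A (exp (s • (c • B)) x)‖ ≤ Real.exp b * ‖shiftSq A x‖ := by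
  refine (norm_exp_smul_apply_le (shiftSq A) (c • B) (b := b / 2) (fun y => ?_) hs x).trans ?_
  · rw [smul_apply, map_smul, norm_smul, hc]
    linarith [h.bound_two y]
  · have := h.nonneg
    gcongr
    nlinarith

lemma norm_exp_left_eq (h : IsSplitting A B b) {c : ℂ} (hc : star c = -c) (s : ℝ) (x : E) :
    ‖shiftSq A (exp (s • (c • A)) x)‖ = ‖shiftSq A x‖ := by
  have hcomm : Commute (shiftSq A) (exp (s • (c • A))) := by
    refine Commute.exp_right ?_
    refine Commute.smul_right (Commute.smul_right ?_ c) s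
    exact ((Commute.refl A).add_left (Commute.one_left A)).pow_left 2
  have : shiftSq A (exp (s • (c • A)) x) = exp (s • (c • A)) (shiftSq A x) :=
    congrArg (fun T : E →L[ℂ] E => T x) hcomm.eq
  rw [this, norm_exp_smul_skew_apply h.selfAdjoint_left hc]

end IsSplitting

/-- Up to unitary factors, the defect of the Strang propagator in the equation
`y' = -i(A + B)y`; see `hasDerivAt_strangFlow`. -/
noncomputable def strangDefect (A B : E →L[ℂ] E) (s : ℝ) : E →L[ℂ] E :=
  (1 / 2 : ℂ) • (exp (s • (Complex.I • A)) * B * exp (s • -(Complex.I • A)) - B) + A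
    - exp (s • (-(Complex.I / 2) • B)) * A * exp (s • -(-(Complex.I / 2) • B))

/-- The derivative of `strangDefect` in `s`. It vanishes at `s = 0`, because the two commutator
terms cancel there: this is where the symmetry of the splitting enters. -/
noncomputable def strangDefectDeriv (A B : E →L[ℂ] E) (s : ℝ) : E →L[ℂ] E :=
  (Complex.I / 2) •
    (exp (s • (Complex.I • A)) * (A * B - B * A) * exp (s • -(Complex.I • A)) -
      exp (s • (-(Complex.I / 2) • B)) * (A * B - B * A) * exp (s • -(-(Complex.I / 2) • B)))

lemma hasDerivAt_strangDefect (A B : E →L[ℂ] E) (s : ℝ) :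
    HasDerivAt (strangDefect A B) (strangDefectDeriv A B s) s := by
  have h1 := hasDerivAt_exp_conj (Complex.I • A) B s
  have h2 := hasDerivAt_exp_conj (-(Complex.I / 2) • B) A s
  refine ((((h1.sub_const B).const_smul (1 / 2 : ℂ)).add_const A).sub h2).congr_deriv ?_
  rw [strangDefectDeriv]
  simp only [smul_mul_assoc, mul_smul_comm, ← smul_sub, smul_smul, mul_sub, sub_mul]
  module

lemma hasDerivAt_strangDefectDeriv (A B : E →L[ℂ] E) (s : ℝ) :
    HasDerivAt (strangDefectDeriv A B) ((Complex.I / 2) • (Complex.I •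
      (exp (s • (Complex.I • A)) * (A * (A * B - B * A) - (A * B - B * A) * A)
        * exp (s • -(Complex.I • A))) + (Complex.I / 2) •
      (exp (s • (-(Complex.I / 2) • B)) * (B * (A * B - B * A) - (A * B - B * A) * B) *
        exp (s • -(-(Complex.I / 2) • B))))) s := by
  have h1 := hasDerivAt_exp_conj (Complex.I • A) (A * B - B * A) s
  have h2 := hasDerivAt_exp_conj (-(Complex.I / 2) • B) (A * B - B * A) s
  refine ((h1.sub h2).const_smul (Complex.I / 2)).congr_deriv ?_
  simp only [smul_mul_assoc, mul_smul_comm, ← smul_sub]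
  module

lemma strangDefect_zero (A B : E →L[ℂ] E) : strangDefect A B 0 = 0 := by
  simp [strangDefect]

lemma strangDefectDeriv_zero (A B : E →L[ℂ] E) : strangDefectDeriv A B 0 = 0 := by
  simp [strangDefectDeriv]

/-- The Strang propagator solves the full equation up to a defect. -/
lemma hasDerivAt_strangFlow (A B : E →L[ℂ] E) (s : ℝ) :
    HasDerivAt (strangFlow A B) (-Complex.I • (strangFlow A B s * (A + B)) -
      Complex.I • (exp (s • (-(Complex.I / 2) • B)) * exp (s • (-Complex.I • A)) *
        strangDefect A B s * exp (s • (-(Complex.I / 2) • B)))) s := by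
  have hP := hasDerivAt_exp_smul_const (𝕂 := ℝ) (-(Complex.I / 2) • B) s
  have hP' := hasDerivAt_exp_smul_const' (𝕂 := ℝ) (-(Complex.I / 2) • B) s
  have hQ := hasDerivAt_exp_smul_const (𝕂 := ℝ) (-Complex.I • A) s
  refine ((hP.mul hQ).mul hP).congr_deriv ?_
  have hPB : B * exp (s • (-(Complex.I / 2) • B)) = exp (s • (-(Complex.I / 2) • B)) * B :=
    (Commute.exp_right (((Commute.refl B).smul_right _).smul_right _)).eq
  have hQi : exp (s • (-Complex.I • A)) * exp (s • (Complex.I • A)) = 1 := by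
    have := exp_mul_exp_neg (s • (-Complex.I • A))
    rwa [← smul_neg, ← neg_smul, neg_neg] at this
  have hQi' : s • -(Complex.I • A) = s • (-Complex.I • A) := by rw [neg_smul]
  have hPi : exp (s • -(-(Complex.I / 2) • B)) * exp (s • (-(Complex.I / 2) • B)) = 1 := by
    have := exp_mul_exp_neg (s • -(-(Complex.I / 2) • B))
    rwa [← smul_neg s, neg_neg] at this
  rw [strangFlow, strangDefect, hQi']
  dsimp only [Pi.mul_apply]
  generalize exp (s • (-(Complex.I / 2) • B)) = P at *
  generalize exp (s • -(-(Complex.I / 2) • B)) = P' at *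
  generalize exp (s • (-Complex.I • A)) = Q at *
  generalize exp (s • (Complex.I • A)) = Q' at *
  have e1 : P * Q * ((1 / 2 : ℂ) • (Q' * B * Q - B) + A - P * A * P') * P =
      (1 / 2 : ℂ) • (P * (Q * Q') * B * Q * P - P * Q * B * P) + P * Q * A * P
        - P * Q * P * A * (P' * P) := by
    simp only [mul_add, add_mul, mul_sub, sub_mul, smul_mul_assoc, mul_smul_comm, mul_assoc]
  rw [e1, hQi, hPi, mul_assoc (P * Q) B P, hPB]
  simp only [mul_one, smul_mul_assoc, mul_smul_comm, mul_add, add_mul, mul_assoc]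
  module

/-- The constant in the error bound of Strang splitting. The first term covers steps `τ ≤ 1`; the
summand `2` covers `τ > 1`, where two vectors of norm at most `M` differ by at most `2 τ³ M`. -/
noncomputable def strangConst (b : ℝ) : ℝ :=
  (2 * b + b ^ 2 * Real.exp b) * Real.exp b + 2

lemma strangConst_pos {b : ℝ} (hb : 0 ≤ b) : 0 < strangConst b := by
  rw [strangConst]; positivity

namespace IsSplitting

variable {A B : E →L[ℂ] E} {b : ℝ}

lemma norm_strangFlow_apply (h : IsSplitting A B b) (s : ℝ) (x : E) :
    ‖strangFlow A B s x‖ = ‖x‖ := by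
  have h1 : star (-(Complex.I / 2)) = -(-(Complex.I / 2)) := by simp [neg_div]
  have h2 : star (-Complex.I) = -(-Complex.I) := by simp
  simp only [strangFlow, mul_apply_eq_comp]
  rw [norm_exp_smul_skew_apply h.selfAdjoint_right h1,
    norm_exp_smul_skew_apply h.selfAdjoint_left h2,
    norm_exp_smul_skew_apply h.selfAdjoint_right h1]

/-- The first-order terms of the defect cancel because the splitting is symmetric; the
second-order ones are double commutators. -/
lemma norm_strangDefect_apply_le (h : IsSplitting A B b) {s : ℝ} (hs : 0 ≤ s) (hs1 : s ≤ 1)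
    (x : E) :
    ‖strangDefect A B s x‖ ≤
      (2 * b + b ^ 2 * Real.exp b) * s ^ 2 * ‖shiftSq A x‖ := by
  have hb := h.nonneg
  set κ := (2 * b + b ^ 2 * Real.exp b) * ‖shiftSq A x‖ with hκ
  have hκ0 : 0 ≤ κ := by positivity
  have h2 : ∀ r ∈ Set.Icc (0 : ℝ) s, ‖strangDefectDeriv A B r x‖ ≤ κ * (r - 0) := by
    intro r hr
    have hd : ∀ q ∈ Set.Icc (0 : ℝ) r, HasDerivWithinAt (fun q => strangDefectDeriv A B q x)
        _ (Set.Icc 0 r) q := fun q _ =>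
      hasDerivWithinAt_apply (hasDerivAt_strangDefectDeriv A B q).hasDerivWithinAt
        (hasDerivAt_const q x).hasDerivWithinAt
    have := norm_image_sub_le_of_norm_deriv_le_segment' hd (C := κ) (fun q hq => ?_) r
      ⟨hr.1, le_rfl⟩
    · simpa [strangDefectDeriv_zero] using this
    · have hq1 : q ≤ 1 := (hq.2.le.trans hr.2).trans hs1
      simp only [map_zero, add_zero]
      rw [smul_apply, norm_smul, add_apply]
      have hA := h.norm_commutator_left_le (exp (q • -(Complex.I • A)) x)
      rw [← neg_smul, h.norm_exp_left_eq (by simp)] at hA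
      have hB := h.norm_commutator_right_le (exp (q • -(-(Complex.I / 2) • B)) x)
      have hB' := h.norm_exp_right_le (c := Complex.I / 2) (by simp) hq.1 hq1 x
      have e : -(-(Complex.I / 2) • B) = (Complex.I / 2) • B := by module
      rw [e] at hB
      have h1 : ‖(Complex.I • (exp (q • (Complex.I • A)) *
          (A * (A * B - B * A) - (A * B - B * A) * A) * exp (q • -(Complex.I • A)))) x‖
          ≤ 4 * b * ‖shiftSq A x‖ := by
        rw [smul_apply, norm_smul, Complex.norm_I, one_mul,
          mul_apply_eq_comp, mul_apply_eq_comp,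
          norm_exp_smul_skew_apply h.selfAdjoint_left (by simp), ← neg_smul]
        exact hA
      have h2 : ‖((Complex.I / 2) • (exp (q • (-(Complex.I / 2) • B)) *
          (B * (A * B - B * A) - (A * B - B * A) * B) *
          exp (q • -(-(Complex.I / 2) • B)))) x‖
          ≤ 1 / 2 * (4 * b ^ 2 * (Real.exp b * ‖shiftSq A x‖)) := by
        rw [smul_apply, norm_smul, e,
          mul_apply_eq_comp, mul_apply_eq_comp,
          norm_exp_smul_skew_apply h.selfAdjoint_right (by simp [neg_div])]
        have : ‖Complex.I / 2‖ = 1 / 2 := by simp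
        rw [this]
        gcongr
        exact hB.trans (by gcongr)
      have h3 := (norm_add_le _ _).trans (add_le_add h1 h2)
      have : ‖Complex.I / 2‖ = 1 / 2 := by simp
      rw [this, hκ]
      linarith
  have hd : ∀ q ∈ Set.Icc (0 : ℝ) s, HasDerivWithinAt (fun q => strangDefect A B q x)
      (strangDefectDeriv A B q x) (Set.Icc 0 s) q := fun q _ => by
    simpa using
      hasDerivWithinAt_apply (hasDerivAt_strangDefect A B q).hasDerivWithinAt
        (hasDerivAt_const q x).hasDerivWithinAt
  have := norm_image_sub_le_of_norm_deriv_le_segment' hd (C := κ * s) (fun q hq => by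
    refine (h2 q ⟨hq.1, hq.2.le⟩).trans ?_
    have := hq.2.le
    gcongr
    linarith) s ⟨hs, le_rfl⟩
  simp only [strangDefect_zero, zero_apply, sub_zero] at this
  refine this.trans (le_of_eq ?_)
  rw [hκ]; ring

/-- The local error of Strang splitting is of third order along trajectories in the domain of
`(A + 1)²`. The bound is uniform in `τ`: for `τ > 1` it follows from unitarity. -/
lemma norm_sub_strangFlow_le (h : IsSplitting A B b) {y : ℝ → E} {a τ M : ℝ} (hτ : 0 ≤ τ)
    (hy : ∀ s ∈ Set.Icc a (a + τ),
      HasDerivWithinAt y (-Complex.I • (A + B) (y s)) (Set.Icc a (a + τ)) s)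
    (hM : ∀ s ∈ Set.Icc a (a + τ), ‖shiftSq A (y s)‖ ≤ M) :
    ‖y (a + τ) - strangFlow A B τ (y a)‖ ≤ strangConst b * τ ^ 3 * M := by
  have hb := h.nonneg
  have hM0 : 0 ≤ M := (norm_nonneg _).trans (hM a ⟨le_rfl, by linarith⟩)
  rcases le_total τ 1 with hτ1 | hτ1
  · have hd : ∀ s ∈ Set.Icc a (a + τ),
        HasDerivWithinAt (fun s => strangFlow A B (a + τ - s) (y s)) (Complex.I •
          (exp ((a + τ - s) • (-(Complex.I / 2) • B)) *
            exp ((a + τ - s) • (-Complex.I • A)) * strangDefect A B (a + τ - s) *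
            exp ((a + τ - s) • (-(Complex.I / 2) • B))) (y s)) (Set.Icc a (a + τ)) s := by
      intro s hs
      have h1 := (hasDerivAt_strangFlow A B (a + τ - s)).scomp s
        ((hasDerivAt_id s).const_sub (a + τ))
      refine (hasDerivWithinAt_apply h1.hasDerivWithinAt (hy s hs)).congr_deriv ?_
      simp
      abel
    have := norm_image_sub_le_of_norm_deriv_le_segment' hd
      (C := (2 * b + b ^ 2 * Real.exp b) * τ ^ 2 * (Real.exp b * M)) (fun s hs => ?_) (a + τ)
      ⟨by linarith, le_rfl⟩
    · have e0 : strangFlow A B 0 = 1 := by simp [strangFlow]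
      simp only [sub_self, e0, one_apply_eq_self, add_sub_cancel_left] at this
      refine this.trans ?_
      rw [strangConst]
      have : 0 ≤ 2 * τ ^ 3 * M := by positivity
      nlinarith
    · have hs0 : 0 ≤ a + τ - s := by linarith [hs.2]
      have hs2 : a + τ - s ≤ τ := by linarith [hs.1]
      have hs1 : a + τ - s ≤ 1 := hs2.trans hτ1
      simp only [mul_apply_eq_comp, norm_smul, Complex.norm_I, one_mul]
      rw [norm_exp_smul_skew_apply h.selfAdjoint_right (c := -(Complex.I / 2)) (by simp [neg_div]),
        norm_exp_smul_skew_apply h.selfAdjoint_left (c := -Complex.I) (by simp)]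
      refine (h.norm_strangDefect_apply_le hs0 hs1 _).trans ?_
      gcongr
      exact (h.norm_exp_right_le (by simp) hs0 hs1 _).trans
        (by gcongr; exact hM s ⟨hs.1, hs.2.le⟩)
  · have hle : ∀ s ∈ Set.Icc a (a + τ), ‖y s‖ ≤ M := fun s hs =>
      (h.norm_le _).trans ((h.norm_le_sq _).trans (hM s hs))
    have h1 := hle a ⟨le_rfl, by linarith⟩
    have h2 := hle (a + τ) ⟨by linarith, le_rfl⟩
    have h3 := norm_sub_le (y (a + τ)) (strangFlow A B τ (y a))
    rw [h.norm_strangFlow_apply] at h3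
    have h4 : 1 ≤ τ ^ 3 := one_le_pow₀ hτ1
    have h5 : 2 ≤ strangConst b := by
      rw [strangConst]
      have : 0 ≤ (2 * b + b ^ 2 * Real.exp b) * Real.exp b := by positivity
      linarith
    calc _ ≤ 2 * 1 * M := by linarith
      _ ≤ _ := by gcongr

/-- Unitarity turns the local error bound into a global one. -/
lemma norm_sub_strangFlow_pow_le (h : IsSplitting A B b) {y : ℝ → E} {τ M : ℝ} (hτ : 0 ≤ τ)
    (k : ℕ) (hy : ∀ s ∈ Set.Icc 0 (k * τ),
      HasDerivWithinAt y (-Complex.I • (A + B) (y s)) (Set.Icc 0 (k * τ)) s)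
    (hM : ∀ s ∈ Set.Icc 0 (k * τ), ‖shiftSq A (y s)‖ ≤ M) :
    ‖y (k * τ) - (strangFlow A B τ ^ k) (y 0)‖ ≤ k * (strangConst b * τ ^ 3 * M) := by
  suffices H : ∀ m : ℕ, m ≤ k →
      ‖y (m * τ) - (strangFlow A B τ ^ m) (y 0)‖ ≤ m * (strangConst b * τ ^ 3 * M) from
    H k le_rfl
  intro m
  induction m with
  | zero => simp
  | succ m ih =>
    intro hm
    have ih := ih (by omega)
    have hsub : Set.Icc ((m : ℝ) * τ) (m * τ + τ) ⊆ Set.Icc 0 (k * τ) := by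
      have : ((m + 1 : ℕ) : ℝ) ≤ k := by exact_mod_cast hm
      push_cast at this
      refine Set.Icc_subset_Icc (by positivity) ?_
      nlinarith
    have h1 := h.norm_sub_strangFlow_le hτ (fun s hs => (hy s (hsub hs)).mono hsub)
      (fun s hs => hM s (hsub hs))
    have e : ((m + 1 : ℕ) : ℝ) * τ = m * τ + τ := by push_cast; ring
    rw [e]
    have e2 : y (m * τ + τ) - (strangFlow A B τ ^ (m + 1)) (y 0) =
        (y (m * τ + τ) - strangFlow A B τ (y (m * τ))) +
          strangFlow A B τ (y (m * τ) - (strangFlow A B τ ^ m) (y 0)) := by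
      rw [map_sub, pow_succ', mul_apply_eq_comp]; abel
    rw [e2]
    refine (norm_add_le _ _).trans ?_
    rw [h.norm_strangFlow_apply]
    rw [Nat.cast_succ]
    linarith

end IsSplitting

end Hilbert

end TDSE

namespace TDSE

open UnitAddTorus MeasureTheory

/-! ### Fourier coefficients of continuous functions -/

/-- The real potential as a complex-valued continuous function. -/
def toComplex {d : ℕ} (v : C(Torus d, ℝ)) : C(Torus d, ℂ) :=
  ⟨fun x => (v x : ℂ), Complex.continuous_ofReal.comp v.continuous⟩

lemma torusFourierCoeff_eq {d : ℕ} (f : Torus d → ℂ) (l : Fin d → ℤ) :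
    torusFourierCoeff f l = mFourierCoeff f l := by
  rw [torusFourierCoeff, mFourierCoeff]
  simp only [smul_eq_mul, mul_comm]
  rfl

lemma integral_mul_eq_inner {d : ℕ} (f φ : C(Torus d, ℂ)) :
    ∫ x, f x * φ x ∂(torusMeasure d) =
      inner ℂ (ContinuousMap.toLp (E := ℂ) 2 (torusMeasure d) ℂ (star φ))
        (ContinuousMap.toLp (E := ℂ) 2 (torusMeasure d) ℂ f) := by
  rw [ContinuousMap.inner_toLp]
  simp

/-- The Fourier coefficient as a continuous linear functional on `C(𝕋^d)`. -/
noncomputable def coeffCLM {d : ℕ} (l : Fin d → ℤ) : C(Torus d, ℂ) →L[ℂ] ℂ :=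
  (innerSL ℂ (ContinuousMap.toLp (E := ℂ) 2 (torusMeasure d) ℂ (star (mFourier (-l))))).comp
    (ContinuousMap.toLp (E := ℂ) 2 (torusMeasure d) ℂ)

lemma coeffCLM_apply {d : ℕ} (l : Fin d → ℤ) (f : C(Torus d, ℂ)) :
    coeffCLM l f = torusFourierCoeff f l := by
  rw [torusFourierCoeff, integral_mul_eq_inner]
  rfl

lemma hasSum_torusFourierCoeff {d : ℕ} {f : C(Torus d, ℂ)}
    (hf : Summable (torusFourierCoeff f)) :
    HasSum (fun l => torusFourierCoeff f l • mFourier l) f := by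
  have e : torusFourierCoeff f = mFourierCoeff f := funext (torusFourierCoeff_eq f)
  rw [e] at hf ⊢
  exact hasSum_mFourier_series_of_summable hf

lemma torusFourierCoeff_mul_mFourier {d : ℕ} (f : C(Torus d, ℂ)) (k l : Fin d → ℤ) :
    torusFourierCoeff (f * mFourier k : C(Torus d, ℂ)) l = torusFourierCoeff f (l - k) := by
  rw [torusFourierCoeff, torusFourierCoeff]
  congr 1
  ext x
  rw [ContinuousMap.mul_apply, mul_assoc, ← mFourier_add]
  congr 3
  abel

/-- The Fourier coefficients of a product form the convolution of the coefficients. -/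
lemma hasSum_torusFourierCoeff_mul {d : ℕ} (f : C(Torus d, ℂ)) {w : C(Torus d, ℂ)}
    (hw : Summable (torusFourierCoeff w)) (l : Fin d → ℤ) :
    HasSum (fun k => torusFourierCoeff w k * torusFourierCoeff f (l - k))
      (torusFourierCoeff (f * w : C(Torus d, ℂ)) l) := by
  have h := ((hasSum_torusFourierCoeff hw).mul_left f).mapL (coeffCLM l)
  simpa only [coeffCLM_apply, mul_smul_comm, map_smul, torusFourierCoeff_mul_mFourier,
    smul_eq_mul] using h

/-- The functions with absolutely summable Fourier coefficients form a Banach algebra. -/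
lemma tsum_enorm_torusFourierCoeff_mul_le {d : ℕ} (f : C(Torus d, ℂ)) {w : C(Torus d, ℂ)}
    (hw : Summable (torusFourierCoeff w)) :
    ∑' l, ‖torusFourierCoeff (f * w : C(Torus d, ℂ)) l‖ₑ ≤
      (∑' l, ‖torusFourierCoeff f l‖ₑ) * ∑' l, ‖torusFourierCoeff w l‖ₑ := by
  calc ∑' l, ‖torusFourierCoeff (f * w : C(Torus d, ℂ)) l‖ₑ
      ≤ ∑' l, ∑' k, ‖torusFourierCoeff w k‖ₑ * ‖torusFourierCoeff f (l - k)‖ₑ := by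
        refine ENNReal.tsum_le_tsum fun l => ?_
        rw [← (hasSum_torusFourierCoeff_mul f hw l).tsum_eq]
        simpa only [enorm_mul] using enorm_tsum_le_tsum_enorm
          (f := fun k => torusFourierCoeff w k * torusFourierCoeff f (l - k))
    _ = ∑' k, ‖torusFourierCoeff w k‖ₑ * ∑' l, ‖torusFourierCoeff f (l - k)‖ₑ := by
        rw [ENNReal.tsum_comm]
        simp only [ENNReal.tsum_mul_left]
    _ = ∑' k, ‖torusFourierCoeff w k‖ₑ * ∑' l, ‖torusFourierCoeff f l‖ₑ := by
        congr 1
        ext k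
        rw [← (Equiv.subRight k).tsum_eq (fun l => ‖torusFourierCoeff f l‖ₑ)]
        rfl
    _ = _ := by rw [ENNReal.tsum_mul_right, mul_comm]

lemma summable_torusFourierCoeff_mul {d : ℕ} {f w : C(Torus d, ℂ)}
    (hf : Summable (torusFourierCoeff f)) (hw : Summable (torusFourierCoeff w)) :
    Summable (torusFourierCoeff (f * w : C(Torus d, ℂ))) := by
  have h1 := (tsum_enorm_torusFourierCoeff_mul_le f hw).trans_lt
    (ENNReal.mul_lt_top (tsum_enorm_ne_top_iff_summable_norm.2 hf.norm).lt_top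
      (tsum_enorm_ne_top_iff_summable_norm.2 hw.norm).lt_top)
  exact .of_enorm h1.ne

/-! ### Exponentials under the Laplacian -/

/-- The phase `y ↦ 2πi l·y` of the exponential of frequency `l`. -/
noncomputable def phase {d : ℕ} (l : Fin d → ℤ) : EuclideanSpace ℝ (Fin d) →L[ℝ] ℂ :=
  ∑ j, (2 * Real.pi * Complex.I * (l j : ℂ)) •
    (Complex.ofRealCLM.comp (EuclideanSpace.proj j : EuclideanSpace ℝ (Fin d) →L[ℝ] ℝ))

lemma phase_apply {d : ℕ} (l : Fin d → ℤ) (y : EuclideanSpace ℝ (Fin d)) :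
    phase l y = ∑ j, 2 * Real.pi * Complex.I * (l j : ℂ) * (y j : ℂ) := by
  simp [phase]

lemma mFourier_coe_apply {d : ℕ} (l : Fin d → ℤ) (y : Fin d → ℝ) :
    mFourier l (fun j => (y j : UnitAddCircle)) =
      Complex.exp (∑ j, 2 * Real.pi * Complex.I * (l j : ℂ) * (y j : ℂ)) := by
  rw [Complex.exp_sum]
  simp [mFourier]

lemma periodicLift_mFourier {d : ℕ} (l : Fin d → ℤ) :
    periodicLift (mFourier l) = fun y => Complex.exp (phase l y) := by
  ext y
  rw [periodicLift, phase_apply, mFourier_coe_apply]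

lemma isSmooth_mFourier {d : ℕ} (l : Fin d → ℤ) : IsSmooth (mFourier l) := by
  rw [IsSmooth, periodicLift_mFourier]
  exact Complex.contDiff_exp.comp (phase l).contDiff

lemma hasFDerivAt_exp_phase {d : ℕ} (l : Fin d → ℤ) (y : EuclideanSpace ℝ (Fin d)) :
    HasFDerivAt (fun y => Complex.exp (phase l y)) (Complex.exp (phase l y) • phase l) y :=
  ((phase l).hasFDerivAt (x := y)).cexp

lemma torusLaplacian_mFourier {d : ℕ} (l : Fin d → ℤ) (x : Torus d) :
    torusLaplacian (mFourier l) x = -(4 * Real.pi ^ 2 * freqNorm l ^ 2 : ℝ) * mFourier l x := by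
  have hx : mFourier l x = Complex.exp (phase l (representative x)) := by
    rw [phase_apply, ← mFourier_coe_apply]
    congr 1
    ext j
    exact ((AddCircle.equivIco (1 : ℝ) 0).symm_apply_apply (x j)).symm
  have h1 : fderiv ℝ (fun y => Complex.exp (phase l y)) =
      fun y => Complex.exp (phase l y) • phase l :=
    funext fun y => (hasFDerivAt_exp_phase l y).fderiv
  have h2 : ∀ y, fderiv ℝ (fun y => Complex.exp (phase l y) • phase l) y =
      (Complex.exp (phase l y) • phase l).smulRight (phase l) := fun y =>
    ((hasFDerivAt_exp_phase l y).smul_const (phase l)).fderiv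
  have h3 : ∀ j, phase l (EuclideanSpace.basisFun (Fin d) ℝ j) =
      2 * Real.pi * Complex.I * (l j : ℂ) := by
    intro j
    rw [phase_apply, Finset.sum_eq_single j]
    · simp
    · intro i _ hi; simp [hi]
    · simp
  rw [torusLaplacian, periodicLift_mFourier,
    InnerProductSpace.laplacian_eq_iteratedFDeriv_orthonormalBasis _
      (EuclideanSpace.basisFun (Fin d) ℝ), hx]
  simp only [iteratedFDeriv_two_apply, h1, h2, Matrix.cons_val_zero, Matrix.cons_val_one,
    ContinuousLinearMap.smulRight_apply, smul_apply, h3, smul_eq_mul]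
  have h4 : freqNorm l ^ 2 = ∑ j, (l j : ℝ) ^ 2 := Real.sq_sqrt (by positivity)
  rw [h4]
  push_cast
  rw [Finset.mul_sum, ← Finset.sum_neg_distrib, Finset.sum_mul]
  refine Finset.sum_congr rfl fun j _ => ?_
  ring_nf
  rw [Complex.I_sq]
  ring

/-! ### The Schrödinger equation on the Fourier side -/

/-- Testing the weak equation with exponentials gives an ordinary differential equation for each
Fourier coefficient. -/
lemma IsSolution.hasDerivWithinAt_coeff {d : ℕ} {γ T : ℝ} (hγ : 0 < γ) {v : C(Torus d, ℝ)}
    {g : C(Torus d, ℂ)} {u : ℝ → C(Torus d, ℂ)} (hu : IsSolution γ T v g u) (l : Fin d → ℤ)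
    {t : ℝ} (ht : t ∈ Set.Icc 0 T) :
    HasDerivWithinAt (fun s => torusFourierCoeff (u s) l)
      (-Complex.I * ((2 * Real.pi ^ 2 * γ * freqNorm l ^ 2 : ℝ) * torusFourierCoeff (u t) l +
        (γ : ℂ)⁻¹ * torusFourierCoeff (toComplex v * u t : C(Torus d, ℂ)) l))
      (Set.Icc 0 T) t := by
  have hγ' : (γ : ℂ) ≠ 0 := by exact_mod_cast hγ.ne'
  have h := (hu.equation _ (isSmooth_mFourier (-l)) t ht).const_mul (Complex.I * γ)⁻¹
  have hn : freqNorm (-l) = freqNorm l := by simp [freqNorm]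
  have e1 : ∫ x, u t x * torusLaplacian (mFourier (-l)) x ∂(torusMeasure d) =
      -(4 * Real.pi ^ 2 * freqNorm l ^ 2 : ℝ) * torusFourierCoeff (u t) l := by
    rw [torusFourierCoeff, ← integral_const_mul]
    congr 1
    ext x
    rw [torusLaplacian_mFourier, hn]
    ring
  rw [e1] at h
  refine (h.congr_deriv ?_).congr_of_mem (fun s _ => ?_) ht
  · have e2 : ∫ x, (v x : ℂ) * u t x * mFourier (-l) x ∂(torusMeasure d) =
        torusFourierCoeff (toComplex v * u t : C(Torus d, ℂ)) l := rfl
    rw [e2]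
    field_simp
    push_cast
    ring_nf
    rw [Complex.I_sq]
    ring
  · rw [torusFourierCoeff]
    field_simp

lemma IsSolution.continuousOn_coeff_mul {d : ℕ} {γ T : ℝ} {v : C(Torus d, ℝ)}
    {g : C(Torus d, ℂ)} {u : ℝ → C(Torus d, ℂ)} (hu : IsSolution γ T v g u)
    (w : C(Torus d, ℂ)) (l : Fin d → ℤ) :
    ContinuousOn (fun s => torusFourierCoeff (w * u s : C(Torus d, ℂ)) l) (Set.Icc 0 T) := by
  have e : ∀ s, torusFourierCoeff (w * u s : C(Torus d, ℂ)) l =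
      inner ℂ (ContinuousMap.toLp (E := ℂ) 2 (torusMeasure d) ℂ (star (w * mFourier (-l))))
        (ContinuousMap.toLp (E := ℂ) 2 (torusMeasure d) ℂ (u s)) := by
    intro s
    rw [← integral_mul_eq_inner, torusFourierCoeff]
    congr 1
    ext x
    simp only [ContinuousMap.mul_apply]
    ring
  simp only [e]
  exact continuousOn_const.inner hu.continuousOn

variable {d r : ℕ} {Z : Matrix (Fin d) (Fin r) ℤ} {n : Fin r → ℕ}
  {h : MultiIndex n → Fin d → ℤ}

/-! ### Residue classes of frequencies -/

/-- The index `ξ` of the residue class `A(Z, n, ξ)` that contains `l`. -/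
def residue (Z : Matrix (Fin d) (Fin r) ℤ) (hn : ∀ i, 0 < n i) (l : Fin d → ℤ) :
    MultiIndex n := fun i =>
  ⟨(Z.transpose.mulVec l i % n i).toNat, by
    have h1 : (0 : ℤ) < n i := by exact_mod_cast hn i
    have := Int.emod_lt_of_pos (Z.transpose.mulVec l i) h1
    have := Int.emod_nonneg (Z.transpose.mulVec l i) h1.ne'
    omega⟩

lemma residue_eq_iff (hn : ∀ i, 0 < n i) {l : Fin d → ℤ} {ξ : MultiIndex n} :
    residue Z hn l = ξ ↔ l ∈ residueClass Z n ξ := by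
  rw [funext_iff, residueClass, Set.mem_ofPred_eq]
  refine forall_congr' fun i => ?_
  have h1 : (0 : ℤ) < n i := by exact_mod_cast hn i
  have h2 := Int.emod_nonneg (Z.transpose.mulVec l i) h1.ne'
  have h3 : ((ξ i : ℕ) : ℤ) % n i = (ξ i : ℕ) :=
    Int.emod_eq_of_lt (by positivity) (by exact_mod_cast (ξ i).2)
  rw [Int.ModEq, h3, Fin.ext_iff, residue]
  dsimp only
  omega

lemma mem_residueClass_residue (hn : ∀ i, 0 < n i) (l : Fin d → ℤ) :
    l ∈ residueClass Z n (residue Z hn l) :=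
  (residue_eq_iff hn).1 rfl

lemma residue_eq_residue_iff (hn : ∀ i, 0 < n i) {l m : Fin d → ℤ} :
    residue Z hn l = residue Z hn m ↔
      ∀ i, (n i : ℤ) ∣ Z.transpose.mulVec (l - m) i := by
  rw [residue_eq_iff, residueClass, Set.mem_ofPred_eq]
  refine forall_congr' fun i => ?_
  have h1 : m ∈ residueClass Z n (residue Z hn m) := mem_residueClass_residue hn m
  rw [Matrix.mulVec_sub, Pi.sub_apply, ← Int.modEq_iff_dvd]
  exact ⟨fun h => (h1 i).trans h.symm, fun h => h.symm.trans (h1 i)⟩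

lemma IsMinimalAntiAliasing.residue_apply (hh : IsMinimalAntiAliasing Z n h)
    (hn : ∀ i, 0 < n i) (ξ : MultiIndex n) : residue Z hn (h ξ) = ξ :=
  (residue_eq_iff hn).2 (hh.mem ξ)

lemma IsMinimalAntiAliasing.injective (hh : IsMinimalAntiAliasing Z n h)
    (hn : ∀ i, 0 < n i) : Function.Injective h :=
  Function.LeftInverse.injective (hh.residue_apply hn)

lemma IsMinimalAntiAliasing.residue_add_eq_iff (hh : IsMinimalAntiAliasing Z n h)
    (hn : ∀ i, 0 < n i) (l : Fin d → ℤ) (ξ ζ : MultiIndex n) :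
    residue Z hn (l + h ζ) = ξ ↔ ζ = residue Z hn (h ξ - l) := by
  nth_rewrite 1 [← hh.residue_apply hn ξ]
  nth_rewrite 2 [← hh.residue_apply hn ζ]
  rw [residue_eq_residue_iff, residue_eq_residue_iff]
  have : l + h ζ - h ξ = h ζ - (h ξ - l) := by abel
  rw [this]

/-! ### Orthogonality of the exponentials on the lattice points -/

lemma sum_exp_two_pi_mul_div {N : ℕ} (hN : 0 < N) (m : ℤ) :
    ∑ k : Fin N, Complex.exp (2 * Real.pi * Complex.I * m * (k : ℕ) / N) =
      if (N : ℤ) ∣ m then (N : ℂ) else 0 := by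
  have hN' : (N : ℂ) ≠ 0 := by exact_mod_cast hN.ne'
  have hpi : (2 * Real.pi * Complex.I : ℂ) ≠ 0 := Complex.two_pi_I_ne_zero
  set ω := Complex.exp (2 * Real.pi * Complex.I * m / N) with hω
  have e : ∀ k : ℕ, Complex.exp (2 * Real.pi * Complex.I * m * k / N) = ω ^ k := by
    intro k
    rw [hω, ← Complex.exp_nat_mul]
    congr 1
    ring
  simp only [e]
  rw [Fin.sum_univ_eq_sum_range (fun k => ω ^ k)]
  have h1 : ω ^ N = 1 := by
    rw [← e, Complex.exp_eq_one_iff]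
    exact ⟨m, by field_simp⟩
  have h2 : ω = 1 ↔ (N : ℤ) ∣ m := by
    rw [hω, Complex.exp_eq_one_iff]
    constructor
    · rintro ⟨q, hq⟩
      refine ⟨q, ?_⟩
      have : (m : ℂ) = N * q := by
        field_simp at hq
        exact hq
      exact_mod_cast this
    · rintro ⟨q, rfl⟩
      refine ⟨q, ?_⟩
      push_cast
      field_simp
  split_ifs with hd
  · simp [h2.2 hd]
  · have h3 := mul_neg_geom_sum ω N
    rw [h1, sub_self] at h3
    exact (mul_eq_zero.1 h3).resolve_left (sub_ne_zero.2 fun h => hd (h2.1 h.symm))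

lemma mFourier_latticePoint (l : Fin d → ℤ) (k : MultiIndex n) :
    mFourier l (latticePoint Z n k) = ∏ i,
      Complex.exp (2 * Real.pi * Complex.I * (Z.transpose.mulVec l i : ℤ) * (k i : ℕ) / n i) := by
  have := mFourier_coe_apply l (fun j => ∑ i, (Z j i : ℝ) * ((k i : ℕ) : ℝ) / (n i : ℝ))
  refine this.trans ?_
  rw [← Complex.exp_sum]
  congr 1
  simp only [Matrix.mulVec, dotProduct, Matrix.transpose_apply]
  push_cast
  simp only [Finset.mul_sum, Finset.sum_mul, Finset.sum_div]
  rw [Finset.sum_comm]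
  refine Finset.sum_congr rfl fun i _ => Finset.sum_congr rfl fun j _ => ?_
  ring

lemma sum_mFourier_latticePoint (hn : ∀ i, 0 < n i) (l : Fin d → ℤ) :
    ∑ k : MultiIndex n, mFourier l (latticePoint Z n k) =
      if ∀ i, (n i : ℤ) ∣ Z.transpose.mulVec l i then ((∏ i, n i : ℕ) : ℂ) else 0 := by
  simp only [mFourier_latticePoint]
  have := Finset.prod_univ_sum (fun i : Fin r => (Finset.univ : Finset (Fin (n i))))
    (fun i k => Complex.exp (2 * Real.pi * Complex.I * (Z.transpose.mulVec l i : ℤ) *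
      (k : ℕ) / n i))
  rw [Fintype.piFinset_univ] at this
  rw [← this]
  simp only [sum_exp_two_pi_mul_div (hn _)]
  split_ifs with hd
  · push_cast
    exact Finset.prod_congr rfl fun i _ => if_pos (hd i)
  · push Not at hd
    obtain ⟨i, hi⟩ := hd
    exact Finset.prod_eq_zero (Finset.mem_univ i) (if_neg hi)

lemma natCast_prod_ne_zero (hn : ∀ i, 0 < n i) : ((∏ i, n i : ℕ) : ℂ) ≠ 0 := by
  exact_mod_cast (Finset.prod_pos fun i _ => hn i).ne'

/-- Aliasing: the lattice rule does not distinguish frequencies of the same residue class. -/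
lemma IsMinimalAntiAliasing.latticeCoeff_mFourier (hh : IsMinimalAntiAliasing Z n h)
    (hn : ∀ i, 0 < n i) (l : Fin d → ℤ) (ξ : MultiIndex n) :
    latticeCoeff Z n (mFourier l) (h ξ) = if residue Z hn l = ξ then 1 else 0 := by
  have e : residue Z hn l = ξ ↔ ∀ i, (n i : ℤ) ∣ Z.transpose.mulVec (l + -h ξ) i := by
    nth_rewrite 1 [← hh.residue_apply hn ξ]
    rw [residue_eq_residue_iff, sub_eq_add_neg]
  rw [latticeCoeff]
  simp only [← mFourier_add, sum_mFourier_latticePoint hn, e]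
  split_ifs
  · rw [one_div, inv_mul_cancel₀ (natCast_prod_ne_zero hn)]
  · simp

/-! ### The discrete Fourier transform of samples -/

lemma latticeCoeff_add (f g : Torus d → ℂ) (l : Fin d → ℤ) :
    latticeCoeff Z n (f + g) l = latticeCoeff Z n f l + latticeCoeff Z n g l := by
  simp only [latticeCoeff, Pi.add_apply, add_mul, Finset.sum_add_distrib, mul_add]

lemma latticeCoeff_smul (c : ℂ) (f : Torus d → ℂ) (l : Fin d → ℤ) :
    latticeCoeff Z n (c • f) l = c * latticeCoeff Z n f l := by
  simp only [latticeCoeff, Pi.smul_apply, smul_eq_mul, mul_assoc, ← Finset.mul_sum]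
  ring

/-- The map sending `f` to the vector `(f̂_a(h_ξ))_ξ`, as a continuous linear map. -/
noncomputable def sample (Z : Matrix (Fin d) (Fin r) ℤ) (n : Fin r → ℕ)
    (h : MultiIndex n → Fin d → ℤ) : C(Torus d, ℂ) →L[ℂ] EuclideanSpace ℂ (MultiIndex n) where
  toFun f := WithLp.toLp 2 (latticeCoeffVec Z n h f)
  map_add' f g := by
    ext ξ
    exact latticeCoeff_add f g _
  map_smul' c f := by
    ext ξ
    exact latticeCoeff_smul c f _
  cont := by
    refine (PiLp.continuous_toLp 2 _).comp (continuous_pi fun ξ => ?_)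
    unfold latticeCoeffVec latticeCoeff
    fun_prop

lemma sample_apply (f : C(Torus d, ℂ)) (ξ : MultiIndex n) :
    sample Z n h f ξ = latticeCoeff Z n f (h ξ) := rfl

lemma ofLp_sample (f : C(Torus d, ℂ)) :
    WithLp.ofLp (sample Z n h f) = latticeCoeffVec Z n h f := rfl

lemma IsMinimalAntiAliasing.sample_mFourier (hh : IsMinimalAntiAliasing Z n h)
    (hn : ∀ i, 0 < n i) (l : Fin d → ℤ) :
    sample Z n h (mFourier l) = EuclideanSpace.single (residue Z hn l) 1 := by
  ext ξ
  rw [sample_apply, hh.latticeCoeff_mFourier hn]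
  simp [eq_comm]

lemma IsMinimalAntiAliasing.hasSum_sample (hh : IsMinimalAntiAliasing Z n h)
    (hn : ∀ i, 0 < n i) {f : C(Torus d, ℂ)} (hf : Summable (torusFourierCoeff f)) :
    HasSum (fun l => torusFourierCoeff f l • EuclideanSpace.single (residue Z hn l) (1 : ℂ))
      (sample Z n h f) := by
  simpa only [map_smul, hh.sample_mFourier hn] using
    (hasSum_torusFourierCoeff hf).mapL (sample Z n h)

lemma IsMinimalAntiAliasing.sample_trigPoly (hh : IsMinimalAntiAliasing Z n h)
    (hn : ∀ i, 0 < n i) (c : MultiIndex n → ℂ) :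
    sample Z n h (trigPoly h c) = WithLp.toLp 2 c := by
  rw [trigPoly, map_sum]
  simp only [map_smul, hh.sample_mFourier hn, hh.residue_apply hn]
  ext ξ
  simp [Pi.single_apply]

lemma IsMinimalAntiAliasing.sample_mFourier_mul_trigPoly (hh : IsMinimalAntiAliasing Z n h)
    (hn : ∀ i, 0 < n i) (l : Fin d → ℤ) (c : MultiIndex n → ℂ) (ξ : MultiIndex n) :
    sample Z n h (mFourier l * trigPoly h c) ξ = c (residue Z hn (h ξ - l)) := by
  have e : ∀ ζ, mFourier l * mFourier (h ζ) = (mFourier (l + h ζ) : C(Torus d, ℂ)) := fun ζ => by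
    ext x
    rw [ContinuousMap.mul_apply, mFourier_add]
  rw [trigPoly, Finset.mul_sum, map_sum]
  simp only [mul_smul_comm, map_smul, e, hh.sample_mFourier hn]
  simp [Pi.single_apply, eq_comm (a := ξ), hh.residue_add_eq_iff hn]

lemma IsMinimalAntiAliasing.dftMatrix_apply (hh : IsMinimalAntiAliasing Z n h)
    (ξ k : MultiIndex n) :
    dftMatrix n ξ k = ((∏ i, 1 / √(n i : ℝ) : ℝ) : ℂ) * mFourier (-h ξ) (latticePoint Z n k) := by
  rw [dftMatrix, Matrix.of_apply, Finset.prod_mul_distrib, mFourier_latticePoint]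
  push_cast
  congr 1
  refine Finset.prod_congr rfl fun i _ => ?_
  obtain ⟨q, hq⟩ := (hh.mem ξ i).dvd
  rcases Nat.eq_zero_or_pos (n i) with h0 | h0
  · simp [h0]
  have h0' : (n i : ℂ) ≠ 0 := by exact_mod_cast h0.ne'
  rw [Complex.exp_eq_exp_iff_exists_int]
  refine ⟨-q * (k i : ℕ), ?_⟩
  have hq' : ((ξ i : ℕ) : ℂ) = (Z.transpose.mulVec (h ξ) i : ℤ) + n i * q := by
    have : (((ξ i : ℕ) : ℤ) : ℂ) = ((Z.transpose.mulVec (h ξ) i + n i * q : ℤ) : ℂ) := by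
      congr 1; linarith
    push_cast at this ⊢
    exact this
  rw [hq', Matrix.mulVec_neg, Pi.neg_apply]
  push_cast
  field_simp
  ring

lemma ofReal_prod_sq (n : Fin r → ℕ) :
    ((∏ i, 1 / √(n i : ℝ) : ℝ) : ℂ) * ((∏ i, 1 / √(n i : ℝ) : ℝ) : ℂ) =
      1 / ((∏ i, n i : ℕ) : ℂ) := by
  rw [← Complex.ofReal_mul, ← Finset.prod_mul_distrib]
  have : ∀ i, 1 / √(n i : ℝ) * (1 / √(n i : ℝ)) = 1 / (n i : ℝ) := fun i => by
    rw [div_mul_div_comm, Real.mul_self_sqrt (by positivity), one_mul]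
  simp only [this, Finset.prod_div_distrib, Finset.prod_const_one]
  push_cast
  rfl

lemma IsMinimalAntiAliasing.dftMatrix_mul_conjTranspose (hh : IsMinimalAntiAliasing Z n h)
    (hn : ∀ i, 0 < n i) : dftMatrix n * (dftMatrix n).conjTranspose = 1 := by
  ext ξ ζ
  have h1 := hh.latticeCoeff_mFourier hn (h ζ) ξ
  rw [hh.residue_apply hn, latticeCoeff, ← ofReal_prod_sq] at h1
  rw [Matrix.mul_apply, Matrix.one_apply]
  simp only [eq_comm (a := ξ)]
  rw [← h1, Finset.mul_sum]
  refine Finset.sum_congr rfl fun k _ => ?_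
  have h2 : star (mFourier (-h ζ) (latticePoint Z n k)) = mFourier (h ζ) (latticePoint Z n k) := by
    rw [mFourier_neg]; exact star_star _
  rw [Matrix.conjTranspose_apply, hh.dftMatrix_apply, hh.dftMatrix_apply, star_mul, h2,
    Complex.star_def, Complex.conj_ofReal]
  ring

lemma IsMinimalAntiAliasing.dftMatrix_inv (hh : IsMinimalAntiAliasing Z n h)
    (hn : ∀ i, 0 < n i) : (dftMatrix n)⁻¹ = (dftMatrix n).conjTranspose :=
  Matrix.inv_eq_right_inv (hh.dftMatrix_mul_conjTranspose hn)

lemma IsMinimalAntiAliasing.isHermitian_multMatrix (hh : IsMinimalAntiAliasing Z n h)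
    (hn : ∀ i, 0 < n i) (v : C(Torus d, ℝ)) : (multMatrix Z n v).IsHermitian := by
  rw [multMatrix, hh.dftMatrix_inv hn]
  refine Matrix.isHermitian_mul_mul_conjTranspose _ ?_
  rw [potentialMatrix]
  refine Matrix.isHermitian_diagonal_of_self_adjoint _ ?_
  ext k
  simp

lemma IsMinimalAntiAliasing.latticeCoeffVec_eq_mulVec (hh : IsMinimalAntiAliasing Z n h)
    (f : Torus d → ℂ) :
    latticeCoeffVec Z n h f = ((∏ i, 1 / √(n i : ℝ) : ℝ) : ℂ) •
      (dftMatrix n).mulVec (fun k => f (latticePoint Z n k)) := by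
  ext ξ
  rw [latticeCoeffVec, latticeCoeff, ← ofReal_prod_sq, Pi.smul_apply, Matrix.mulVec, dotProduct,
    smul_eq_mul, mul_assoc, Finset.mul_sum]
  congr 1
  refine Finset.sum_congr rfl fun k _ => ?_
  rw [hh.dftMatrix_apply]
  ring

/-- In the discrete Fourier domain the matrix `W_n` multiplies by the potential. -/
lemma IsMinimalAntiAliasing.multMatrix_mulVec (hh : IsMinimalAntiAliasing Z n h)
    (hn : ∀ i, 0 < n i) (v : C(Torus d, ℝ)) (f : C(Torus d, ℂ)) :
    (multMatrix Z n v).mulVec (latticeCoeffVec Z n h f) =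
      latticeCoeffVec Z n h (toComplex v * f : C(Torus d, ℂ)) := by
  have h1 : (dftMatrix n).conjTranspose * dftMatrix n = 1 :=
    mul_eq_one_comm.1 (hh.dftMatrix_mul_conjTranspose hn)
  rw [hh.latticeCoeffVec_eq_mulVec, hh.latticeCoeffVec_eq_mulVec, Matrix.mulVec_smul, multMatrix,
    hh.dftMatrix_inv hn, ← Matrix.mulVec_mulVec, Matrix.mulVec_mulVec _ (Matrix.conjTranspose _),
    h1, Matrix.one_mulVec, ← Matrix.mulVec_mulVec]
  congr 2
  ext k
  rw [potentialMatrix, Matrix.mulVec_diagonal]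
  rfl

/-- The matrix `W_n` as a superposition of shifts of the index set. -/
lemma IsMinimalAntiAliasing.hasSum_multMatrix_mulVec (hh : IsMinimalAntiAliasing Z n h)
    (hn : ∀ i, 0 < n i) {v : C(Torus d, ℝ)} (hv : Summable (torusFourierCoeff (toComplex v)))
    (c : MultiIndex n → ℂ) (ξ : MultiIndex n) :
    HasSum (fun l => torusFourierCoeff (toComplex v) l * c (residue Z hn (h ξ - l)))
      ((multMatrix Z n v).mulVec c ξ) := by
  have h1 : (multMatrix Z n v).mulVec c = latticeCoeffVec Z n h
      (toComplex v * trigPoly h c : C(Torus d, ℂ)) := by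
    rw [← hh.multMatrix_mulVec hn]
    congr 1
    exact (congrArg WithLp.ofLp (hh.sample_trigPoly hn c)).symm
  have h2 := (((hasSum_torusFourierCoeff hv).mul_right (trigPoly h c)).mapL (sample Z n h)).mapL
    (EuclideanSpace.proj ξ)
  rw [h1]
  refine (h2.congr_fun fun l => ?_)
  rw [smul_mul_assoc, map_smul, map_smul, smul_eq_mul]
  exact congrArg _ (hh.sample_mFourier_mul_trigPoly hn l c ξ).symm

/-! ### The norm of trigonometric polynomials -/

lemma IsMinimalAntiAliasing.normL2_trigPoly (hh : IsMinimalAntiAliasing Z n h)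
    (hn : ∀ i, 0 < n i) (c : MultiIndex n → ℂ) :
    normL2 (trigPoly h c) = ‖(WithLp.toLp 2 c : EuclideanSpace ℂ (MultiIndex n))‖ₑ := by
  have h1 : normL2 (trigPoly h c) =
      ‖ContinuousMap.toLp (E := ℂ) 2 (torusMeasure d) ℂ (trigPoly h c)‖ₑ := by
    rw [Lp.enorm_def, normL2]
    exact eLpNorm_congr_ae (ContinuousMap.coeFn_toLp _ _).symm
  have h2 := orthonormal_mFourier.comp h (hh.injective hn)
  have h3 : ContinuousMap.toLp (E := ℂ) 2 (torusMeasure d) ℂ (trigPoly h c) =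
      ∑ ξ, c ξ • (mFourierLp 2 ∘ h) ξ := by
    rw [trigPoly, map_sum]
    simp only [map_smul]
    rfl
  have h4 : ‖ContinuousMap.toLp (E := ℂ) 2 (torusMeasure d) ℂ (trigPoly h c)‖ =
      ‖(WithLp.toLp 2 c : EuclideanSpace ℂ (MultiIndex n))‖ := by
    rw [EuclideanSpace.norm_eq, ← Real.sqrt_sq (norm_nonneg (ContinuousMap.toLp _ _ _ _))]
    congr 1
    have h5 := h2.inner_sum c c Finset.univ
    have h6 := inner_self_eq_norm_sq_to_K (𝕜 := ℂ)
      (ContinuousMap.toLp (E := ℂ) 2 (torusMeasure d) ℂ (trigPoly h c))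
    rw [h3] at h6 ⊢
    have h7 := h6.symm.trans h5
    simp only [Complex.conj_mul'] at h7
    refine Complex.ofReal_injective ?_
    push_cast at h7 ⊢
    exact h7
  rw [h1, ← ofReal_norm, ← ofReal_norm, h4]

/-! ### Korobov weights -/

/-- The product `∏_j max(|l_j|, 1)`, of which the Korobov weights are essentially powers. -/
noncomputable def mixedWeight {d : ℕ} (l : Fin d → ℤ) : ℝ := ∏ j, max |(l j : ℝ)| 1

lemma one_le_mixedWeight {d : ℕ} (l : Fin d → ℤ) : 1 ≤ mixedWeight l :=
  Finset.one_le_prod fun _ _ => le_max_right _ _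

lemma freqNorm_nonneg {d : ℕ} (l : Fin d → ℤ) : 0 ≤ freqNorm l := Real.sqrt_nonneg _

lemma freqNorm_eq_norm {d : ℕ} (l : Fin d → ℤ) :
    freqNorm l = ‖(WithLp.toLp 2 (fun j => (l j : ℝ)) : EuclideanSpace ℝ (Fin d))‖ := by
  simp [freqNorm, EuclideanSpace.norm_eq]

lemma freqNorm_add_le {d : ℕ} (l m : Fin d → ℤ) :
    freqNorm (l + m) ≤ freqNorm l + freqNorm m := by
  simp only [freqNorm_eq_norm]
  refine le_trans (le_of_eq ?_) (norm_add_le _ _)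
  congr 1
  ext j
  simp

lemma freqNorm_le_sum {d : ℕ} (l : Fin d → ℤ) : freqNorm l ≤ ∑ j, |(l j : ℝ)| := by
  refine Real.sqrt_le_iff.2 ⟨by positivity, ?_⟩
  simpa using Finset.sum_sq_le_sq_sum_of_nonneg (s := Finset.univ)
    (f := fun j => |(l j : ℝ)|) fun i _ => abs_nonneg _

lemma freqNorm_le_mul_mixedWeight {d : ℕ} (l : Fin d → ℤ) :
    freqNorm l ≤ d * mixedWeight l := by
  refine (freqNorm_le_sum l).trans ?_
  have : ∀ j ∈ Finset.univ, |(l j : ℝ)| ≤ mixedWeight l := by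
    intro j _
    refine (le_max_left _ (1 : ℝ)).trans ?_
    rw [mixedWeight, ← Finset.mul_prod_erase _ _ (Finset.mem_univ j)]
    exact le_mul_of_one_le_right (by positivity) (Finset.one_le_prod fun _ _ => le_max_right _ _)
  simpa using Finset.sum_le_card_nsmul _ _ _ this

lemma mixedWeight_pow_le {d : ℕ} {α : ℝ} (hα : 9 / 2 ≤ α) (l : Fin d → ℤ) :
    mixedWeight l ^ 9 ≤ korobovWeightSq α l := by
  rw [mixedWeight, ← Finset.prod_pow, korobovWeightSq]
  refine Finset.prod_le_prod (fun i _ => by positivity) fun i _ => ?_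
  rcases eq_or_ne (l i) 0 with h0 | h0
  · simp [h0]
  · have h1 : (1 : ℝ) ≤ |(l i : ℝ)| := by
      rw [← Int.cast_abs]
      exact_mod_cast Int.one_le_abs h0
    rw [max_eq_left h1]
    refine le_trans ?_ (le_max_left _ _)
    rw [← Real.rpow_natCast]
    exact Real.rpow_le_rpow_of_exponent_le h1 (by push_cast; linarith)

/-! ### Sums of `∏_j max(|l_j|, 1)^{-2}` -/

lemma sum_nat_inv_sq_le {H : Finset ℕ} {Y : ℝ} (hY : 0 < Y) (hH : ∀ i ∈ H, Y ≤ (i : ℝ)) :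
    ∑ i ∈ H, ((i : ℝ) ^ 2)⁻¹ ≤ 2 / Y := by
  obtain ⟨k, hk⟩ : ∃ k, ⌈Y⌉₊ = k + 1 := Nat.exists_eq_add_one.2 (Nat.ceil_pos.2 hY)
  have h1 : H ⊆ Finset.Ioo k (H.sup id + 1) := by
    intro i hi
    have h2 : ⌈Y⌉₊ ≤ i := Nat.ceil_le.2 (hH i hi)
    have h3 : i ≤ H.sup id := Finset.le_sup (f := id) hi
    exact Finset.mem_Ioo.2 ⟨by omega, by omega⟩
  refine (Finset.sum_le_sum_of_subset_of_nonneg h1 fun i _ _ => by positivity).trans ?_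
  refine (sum_Ioo_inv_sq_le k _).trans ?_
  have h4 : Y ≤ (k : ℝ) + 1 := by
    have := Nat.le_ceil Y
    rw [hk] at this
    exact_mod_cast this
  gcongr

lemma sum_int_inv_sq_le (G : Finset ℤ) {Y : ℝ} (hY : 0 < Y) :
    ∑ k ∈ G with Y ≤ |((k : ℤ) : ℝ)|, ((max |(k : ℝ)| 1) ^ 2)⁻¹ ≤ 4 / Y := by
  have key : ∀ H : Finset ℤ, Set.InjOn Int.natAbs (H : Set ℤ) → (∀ k ∈ H, Y ≤ |(k : ℝ)|) →
      ∑ k ∈ H, ((max |(k : ℝ)| 1) ^ 2)⁻¹ ≤ 2 / Y := by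
    intro H hH hHY
    have h1 := sum_nat_inv_sq_le (H := H.image Int.natAbs) hY (fun i hi => by
      obtain ⟨k, hk, rfl⟩ := Finset.mem_image.1 hi
      rw [Nat.cast_natAbs, Int.cast_abs]
      exact hHY k hk)
    rw [Finset.sum_image hH] at h1
    refine le_trans (Finset.sum_le_sum fun k hk => ?_) h1
    have h2 : 0 < |(k : ℝ)| := hY.trans_le (hHY k hk)
    rw [Nat.cast_natAbs, Int.cast_abs]
    gcongr
    exact le_max_left _ _
  rw [← Finset.sum_filter_add_sum_filter_not _ (fun k : ℤ => 0 ≤ k)]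
  have e : 4 / Y = 2 / Y + 2 / Y := by ring
  rw [e]
  refine add_le_add (key _ ?_ ?_) (key _ ?_ ?_)
  · intro k hk l hl hkl
    simp only [Finset.coe_filter, Finset.mem_filter, Set.mem_ofPred_eq] at hk hl
    omega
  · intro k hk
    exact (Finset.mem_filter.1 (Finset.mem_filter.1 hk).1).2
  · intro k hk l hl hkl
    simp only [Finset.coe_filter, Finset.mem_filter, Set.mem_ofPred_eq] at hk hl
    omega
  · intro k hk
    exact (Finset.mem_filter.1 (Finset.mem_filter.1 hk).1).2

lemma sum_int_max_inv_sq_le (G : Finset ℤ) : ∑ k ∈ G, ((max |(k : ℝ)| 1) ^ 2)⁻¹ ≤ 5 := by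
  rw [← Finset.sum_filter_add_sum_filter_not G (fun k : ℤ => (1 : ℝ) ≤ |(k : ℝ)|)]
  have h1 := sum_int_inv_sq_le G zero_lt_one
  have h2 : ∑ k ∈ G with ¬(1 : ℝ) ≤ |((k : ℤ) : ℝ)|, ((max |(k : ℝ)| 1) ^ 2)⁻¹ ≤ 1 := by
    have h3 : (G.filter fun k : ℤ => ¬(1 : ℝ) ≤ |(k : ℝ)|) ⊆ {0} := by
      intro k hk
      have := (Finset.mem_filter.1 hk).2
      rw [← Int.cast_abs] at this
      have h4 : ¬(1 : ℤ) ≤ |k| := fun h => this (by exact_mod_cast h)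
      rw [Finset.mem_singleton]
      by_contra h5
      exact h4 (Int.one_le_abs h5)
    refine (Finset.sum_le_sum_of_subset_of_nonneg h3 fun i _ _ => by positivity).trans ?_
    simp
  linarith

lemma sum_prod_le {d : ℕ} (F : Finset (Fin d → ℤ)) (f : Fin d → ℤ → ℝ)
    (hf : ∀ j k, 0 ≤ f j k) :
    ∑ l ∈ F, ∏ j, f j (l j) ≤ ∏ j, ∑ k ∈ F.image (fun l => l j), f j k := by
  rw [Finset.prod_univ_sum]
  refine Finset.sum_le_sum_of_subset_of_nonneg (fun l hl => ?_) fun l _ _ =>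
    Finset.prod_nonneg fun j _ => hf _ _
  exact Fintype.mem_piFinset.2 fun j => Finset.mem_image_of_mem (fun l => l j) hl

lemma inv_mixedWeight_sq {d : ℕ} (l : Fin d → ℤ) :
    (mixedWeight l ^ 2)⁻¹ = ∏ j, ((max |(l j : ℝ)| 1) ^ 2)⁻¹ := by
  rw [mixedWeight, ← Finset.prod_pow, Finset.prod_inv_distrib]

lemma sum_inv_mixedWeight_sq_le {d : ℕ} (F : Finset (Fin d → ℤ)) :
    ∑ l ∈ F, (mixedWeight l ^ 2)⁻¹ ≤ 5 ^ d := by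
  simp only [inv_mixedWeight_sq]
  refine (sum_prod_le F (fun _ k => ((max |(k : ℝ)| 1) ^ 2)⁻¹) fun _ _ => by positivity).trans ?_
  refine (Finset.prod_le_prod (fun j _ => Finset.sum_nonneg fun _ _ => by positivity)
    fun j _ => sum_int_max_inv_sq_le _).trans ?_
  simp

/-- The tail of `∑_l ∏_j max(|l_j|, 1)^{-2}` decays like the one-dimensional one, since some
coordinate of a large frequency is large. -/
lemma sum_tail_inv_mixedWeight_sq_le {d : ℕ} (F : Finset (Fin d → ℤ)) {X : ℝ} (hX : 0 < X) :
    ∑ l ∈ F with X ≤ freqNorm l, (mixedWeight l ^ 2)⁻¹ ≤ (4 * d ^ 2 * 5 ^ d) / X := by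
  rcases Nat.eq_zero_or_pos d with rfl | hd
  · rw [Finset.filter_false_of_mem]
    · simp
    · intro l _
      have : freqNorm l = 0 := by simp [freqNorm]
      rw [this]
      exact not_le.2 hX
  have hd' : (0 : ℝ) < d := by exact_mod_cast hd
  set Y := X / d with hYdef
  have hY : 0 < Y := by positivity
  have h1 : ∀ l : Fin d → ℤ, X ≤ freqNorm l → ∃ j, Y ≤ |(l j : ℝ)| := by
    intro l hl
    by_contra hc
    push Not at hc
    have := (hl.trans (freqNorm_le_sum l)).trans_lt (Finset.sum_lt_sum_of_nonempty
      (Finset.univ_nonempty_iff.2 ⟨⟨0, hd⟩⟩) fun j _ => hc j)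
    simp only [Finset.sum_const, Finset.card_univ, Fintype.card_fin, nsmul_eq_mul] at this
    rw [hYdef, mul_div_cancel₀ _ hd'.ne'] at this
    exact lt_irrefl _ this
  have h2 : ∀ j : Fin d, ∑ l ∈ F with Y ≤ |((l j : ℤ) : ℝ)|, (mixedWeight l ^ 2)⁻¹ ≤
      4 / Y * 5 ^ d := by
    intro j
    set f : Fin d → ℤ → ℝ := fun i k =>
      if i = j then (if Y ≤ |(k : ℝ)| then ((max |(k : ℝ)| 1) ^ 2)⁻¹ else 0)
        else ((max |(k : ℝ)| 1) ^ 2)⁻¹ with hf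
    have hf0 : ∀ i k, 0 ≤ f i k := by
      intro i k; rw [hf]; dsimp only; split_ifs <;> positivity
    have h3 : ∑ l ∈ F with Y ≤ |((l j : ℤ) : ℝ)|, (mixedWeight l ^ 2)⁻¹ ≤
        ∑ l ∈ F, ∏ i, f i (l i) := by
      rw [Finset.sum_filter]
      refine Finset.sum_le_sum fun l _ => ?_
      split_ifs with hl
      · rw [inv_mixedWeight_sq]
        refine le_of_eq (Finset.prod_congr rfl fun i _ => ?_)
        rw [hf]
        by_cases hij : i = j
        · subst hij; simp [hl]
        · simp [hij]
      · exact Finset.prod_nonneg fun i _ => hf0 _ _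
    refine h3.trans ((sum_prod_le F f hf0).trans ?_)
    rw [← Finset.mul_prod_erase _ _ (Finset.mem_univ j)]
    refine mul_le_mul ?_ ?_ (Finset.prod_nonneg fun i _ => Finset.sum_nonneg fun k _ => hf0 _ _)
      (by positivity)
    · have := sum_int_inv_sq_le (F.image fun l => l j) hY
      rw [Finset.sum_filter] at this
      simpa [hf] using this
    · refine (Finset.prod_le_prod (g := fun _ => (5 : ℝ))
        (fun i _ => Finset.sum_nonneg fun k _ => hf0 _ _) fun i hi => ?_).trans ?_
      · have := sum_int_max_inv_sq_le (F.image fun l => l i)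
        simpa [hf, Finset.ne_of_mem_erase hi] using this
      · rw [Finset.prod_const]
        refine pow_le_pow_right₀ (by norm_num) ?_
        simp
  calc ∑ l ∈ F with X ≤ freqNorm l, (mixedWeight l ^ 2)⁻¹
      ≤ ∑ j : Fin d, ∑ l ∈ F with Y ≤ |((l j : ℤ) : ℝ)|, (mixedWeight l ^ 2)⁻¹ := by
        simp only [Finset.sum_filter]
        rw [Finset.sum_comm]
        refine Finset.sum_le_sum fun l _ => ?_
        have h4 : ∀ j ∈ Finset.univ, 0 ≤ if Y ≤ |((l j : ℤ) : ℝ)| then (mixedWeight l ^ 2)⁻¹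
            else 0 := fun j _ => by split_ifs <;> positivity
        split_ifs with hl
        · obtain ⟨j, hj⟩ := h1 l hl
          refine le_trans (le_of_eq ?_) (Finset.single_le_sum h4 (Finset.mem_univ j))
          rw [if_pos hj]
        · exact Finset.sum_nonneg h4
    _ ≤ ∑ j : Fin d, 4 / Y * 5 ^ d := Finset.sum_le_sum fun j _ => h2 j
    _ = _ := by
        rw [Finset.sum_const, Finset.card_univ, Fintype.card_fin, nsmul_eq_mul, hYdef]
        field_simp

/-! ### Korobov functions -/

lemma korobovWeightSq_pos {d : ℕ} (α : ℝ) (l : Fin d → ℤ) : 0 < korobovWeightSq α l :=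
  Finset.prod_pos fun _ _ => lt_max_of_lt_right one_pos

/-- The exponent `7` leaves exactly the summable power `max(|l_j|, 1)^{-2}` of the weight
with `2α ≥ 9`. -/
lemma sum_tail_freqNorm_pow_div_le {d : ℕ} {α : ℝ} (hα : 9 / 2 ≤ α) (F : Finset (Fin d → ℤ))
    {X : ℝ} (hX : 0 < X) :
    ∑ l ∈ F with X ≤ freqNorm l, freqNorm l ^ 7 / korobovWeightSq α l ≤
      (d ^ 7 * (4 * d ^ 2 * 5 ^ d)) / X := by
  rw [mul_div_assoc]
  refine le_trans ?_ (mul_le_mul_of_nonneg_left (sum_tail_inv_mixedWeight_sq_le F hX)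
    (by positivity))
  rw [Finset.mul_sum]
  refine Finset.sum_le_sum fun l _ => ?_
  have h1 := mixedWeight_pow_le hα l
  have h2 := one_le_mixedWeight l
  have h3 := freqNorm_le_mul_mixedWeight l
  have h4 := freqNorm_nonneg l
  have h5 : 0 < mixedWeight l := by linarith
  calc freqNorm l ^ 7 / korobovWeightSq α l
      ≤ (d * mixedWeight l) ^ 7 / mixedWeight l ^ 9 := by gcongr
    _ = _ := by field_simp

lemma sum_mul_sq_le_of_korobov {d : ℕ} {α : ℝ} {f : Torus d → ℂ}
    (hf : IsKorobov α f) (F : Finset (Fin d → ℤ)) :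
    ∑ l ∈ F, korobovWeightSq α l * ‖torusFourierCoeff f l‖ ^ 2 ≤
      ∑' l, ‖torusFourierCoeff f l‖ ^ 2 * korobovWeightSq α l := by
  simp only [mul_comm (korobovWeightSq α _)]
  exact hf.2.sum_le_tsum F fun l _ => mul_nonneg (by positivity) (korobovWeightSq_pos α l).le

lemma sum_one_add_freqNorm_sq_mul_le {d : ℕ} {α : ℝ} (hα : 9 / 2 ≤ α) {f : Torus d → ℂ}
    (hf : IsKorobov α f) (F : Finset (Fin d → ℤ)) :
    ∑ l ∈ F, (1 + freqNorm l ^ 2) * ‖torusFourierCoeff f l‖ ≤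
      (∑' l, ‖torusFourierCoeff f l‖ ^ 2 * korobovWeightSq α l) + (1 + (d : ℝ) ^ 2) ^ 2 * 5 ^ d := by
  refine le_trans ?_ (add_le_add (sum_mul_sq_le_of_korobov hf F)
    (mul_le_mul_of_nonneg_left (sum_inv_mixedWeight_sq_le F) (by positivity)))
  rw [Finset.mul_sum, ← Finset.sum_add_distrib]
  refine Finset.sum_le_sum fun l _ => ?_
  set ω := korobovWeightSq α l with hω
  set x := ‖torusFourierCoeff f l‖
  set P := mixedWeight l
  have h1 : P ^ 9 ≤ ω := mixedWeight_pow_le hα l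
  have h2 : 1 ≤ P := one_le_mixedWeight l
  have h3 : freqNorm l ≤ d * P := freqNorm_le_mul_mixedWeight l
  have h4 := freqNorm_nonneg l
  have h5 : 0 < ω := korobovWeightSq_pos α l
  have h6 : (1 + freqNorm l ^ 2) ^ 2 / ω ≤ (1 + (d : ℝ) ^ 2) ^ 2 * (P ^ 2)⁻¹ := by
    calc (1 + freqNorm l ^ 2) ^ 2 / ω ≤ (P ^ 2 + (d * P) ^ 2) ^ 2 / P ^ 6 := by
          gcongr
          · exact one_le_pow₀ h2
          · exact (pow_le_pow_right₀ h2 (by norm_num)).trans h1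
      _ = _ := by field_simp
  refine le_trans ?_ (add_le_add le_rfl h6)
  have h7 : (1 + freqNorm l ^ 2) * x * ω ≤ (ω * x ^ 2 + (1 + freqNorm l ^ 2) ^ 2 / ω) * ω := by
    rw [add_mul (ω * x ^ 2), div_mul_cancel₀ _ h5.ne']
    nlinarith [sq_nonneg (ω * x - (1 + freqNorm l ^ 2)), sq_nonneg (ω * x + (1 + freqNorm l ^ 2))]
  exact le_of_mul_le_mul_right h7 h5

lemma summable_of_korobov {d : ℕ} {α : ℝ} (hα : 9 / 2 ≤ α) {f : Torus d → ℂ}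
    (hf : IsKorobov α f) : Summable (torusFourierCoeff f) := by
  refine .of_norm (summable_of_sum_le (fun _ => norm_nonneg _) fun F =>
    le_trans (Finset.sum_le_sum fun l _ => ?_) (sum_one_add_freqNorm_sq_mul_le hα hf F))
  nlinarith [norm_nonneg (torusFourierCoeff f l), sq_nonneg (freqNorm l)]

/-! ### The potential as a superposition of shifts of the index set -/

/-- The permutation of the index set induced by subtraction of the frequency `l`. -/
noncomputable def shiftIdx (hh : IsMinimalAntiAliasing Z n h) (hn : ∀ i, 0 < n i)
    (l : Fin d → ℤ) : Equiv.Perm (MultiIndex n) :=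
  Equiv.ofBijective (fun ξ => residue Z hn (h ξ - l)) (Finite.injective_iff_bijective.1 (by
    intro ξ ζ hξζ
    have h1 := (hh.residue_add_eq_iff hn l ξ _).2 rfl
    have h2 := (hh.residue_add_eq_iff hn l ζ _).2 rfl
    have h3 : residue Z hn (h ξ - l) = residue Z hn (h ζ - l) := hξζ
    rw [← h1, ← h2, h3]))

/-- Minimality of the anti-aliasing set makes shifts of the index set act on frequencies like true
translations, up to a change of size by at most `‖l‖₂`. -/
lemma freqNorm_le_shiftIdx (hh : IsMinimalAntiAliasing Z n h) (hn : ∀ i, 0 < n i)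
    (l : Fin d → ℤ) (ξ : MultiIndex n) :
    freqNorm (h ξ) ≤ freqNorm (h (shiftIdx hh hn l ξ)) + freqNorm l := by
  have h1 := (residue_eq_iff hn).1 ((hh.residue_add_eq_iff hn l ξ _).2 rfl)
  refine (hh.minimal ξ _ h1).trans ((freqNorm_add_le _ _).trans (le_of_eq ?_))
  rw [add_comm]
  rfl

section FiniteShiftSums

variable {ι κ : Type*} [Fintype ι]

lemma norm_sum_perm_le (F : Finset κ) (q : κ → ℝ) (hq : ∀ l, 0 ≤ q l) (σ : κ → Equiv.Perm ι)
    (y : ι → ℝ) :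
    ‖(WithLp.toLp 2 (fun ξ => ∑ l ∈ F, q l * y (σ l ξ)) : EuclideanSpace ℝ ι)‖ ≤
      (∑ l ∈ F, q l) * ‖(WithLp.toLp 2 y : EuclideanSpace ℝ ι)‖ := by
  have e : (WithLp.toLp 2 (fun ξ => ∑ l ∈ F, q l * y (σ l ξ)) : EuclideanSpace ℝ ι) =
      ∑ l ∈ F, q l • WithLp.toLp 2 (y ∘ σ l) := by
    ext ξ
    simp
  rw [e, Finset.sum_mul]
  refine (norm_sum_le _ _).trans (le_of_eq (Finset.sum_congr rfl fun l _ => ?_))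
  rw [norm_smul, Real.norm_of_nonneg (hq l)]
  congr 1
  rw [EuclideanSpace.norm_eq, EuclideanSpace.norm_eq]
  congr 1
  exact Equiv.sum_comp (σ l) fun ξ => ‖y ξ‖ ^ 2

lemma norm_toLp_le_of_abs_le {𝕜 : Type*} [RCLike 𝕜] {x : ι → 𝕜} {y : ι → ℝ}
    (hxy : ∀ ξ, ‖x ξ‖ ≤ y ξ) :
    ‖(WithLp.toLp 2 x : EuclideanSpace 𝕜 ι)‖ ≤ ‖(WithLp.toLp 2 y : EuclideanSpace ℝ ι)‖ := by
  rw [EuclideanSpace.norm_eq, EuclideanSpace.norm_eq]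
  refine Real.sqrt_le_sqrt (Finset.sum_le_sum fun ξ _ => ?_)
  have h1 : y ξ ≤ ‖y ξ‖ := Real.le_norm_self _
  have h2 := (hxy ξ).trans h1
  dsimp only
  gcongr

end FiniteShiftSums

section Multiplier

variable {α : ℝ} {v : C(Torus d, ℝ)}

/-- The contributions of frequencies `l` of the potential that are not small against the output
frequency. They are square-summable in the output by the Cauchy-Schwarz inequality with the weight
`‖l‖⁷ / r_α²(l)`, whose tails decay like the inverse of the cut-off. -/
lemma norm_sum_large_le (hα : 9 / 2 ≤ α) (hh : IsMinimalAntiAliasing Z n h)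
    (hn : ∀ i, 0 < n i) (hv : IsKorobov α (toComplex v)) (F : Finset (Fin d → ℤ))
    (x : MultiIndex n → ℝ) :
    ‖(WithLp.toLp 2 (fun ξ => freqNorm (h ξ) ^ 4 * ∑ l ∈ F with freqNorm (h ξ) / 2 ≤ freqNorm l,
        ‖torusFourierCoeff (toComplex v) l‖ * x (shiftIdx hh hn l ξ)) :
          EuclideanSpace ℝ (MultiIndex n))‖ ≤
      √(256 * (d ^ 7 * (4 * d ^ 2 * 5 ^ d)) *
        (∑' l, ‖torusFourierCoeff (toComplex v) l‖ ^ 2 * korobovWeightSq α l)) *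
        ‖(WithLp.toLp 2 x : EuclideanSpace ℝ (MultiIndex n))‖ := by
  set K : ℝ := d ^ 7 * (4 * d ^ 2 * 5 ^ d) with hK
  set V := ∑' l, ‖torusFourierCoeff (toComplex v) l‖ ^ 2 * korobovWeightSq α l with hV
  have hK0 : 0 ≤ K := by positivity
  have hV0 : 0 ≤ V := tsum_nonneg fun l => mul_nonneg (by positivity) (korobovWeightSq_pos α l).le
  set w : (Fin d → ℤ) → ℝ := fun l => ‖torusFourierCoeff (toComplex v) l‖ with hw
  have hpt : ∀ ξ, (freqNorm (h ξ) ^ 4 * ∑ l ∈ F with freqNorm (h ξ) / 2 ≤ freqNorm l,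
      w l * x (shiftIdx hh hn l ξ)) ^ 2 ≤
      256 * K * ∑ l ∈ F, korobovWeightSq α l * w l ^ 2 * x (shiftIdx hh hn l ξ) ^ 2 := by
    intro ξ
    set μ := freqNorm (h ξ) with hμ
    have hS0 : ∀ l ∈ F, 0 ≤ korobovWeightSq α l * w l ^ 2 * x (shiftIdx hh hn l ξ) ^ 2 :=
      fun l _ => mul_nonneg (mul_nonneg (korobovWeightSq_pos α l).le (sq_nonneg _)) (sq_nonneg _)
    rcases (freqNorm_nonneg (h ξ)).eq_or_lt with h0 | hpos
    · rw [hμ, ← h0]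
      simpa using mul_nonneg (mul_nonneg (by norm_num) hK0) (Finset.sum_nonneg hS0)
    have hpos : 0 < μ := hpos
    have hcs := Finset.sum_sq_le_sum_mul_sum_of_sq_le_mul (F.filter fun l => μ / 2 ≤ freqNorm l)
      (r := fun l => w l * x (shiftIdx hh hn l ξ))
      (f := fun l => freqNorm l ^ 7 / korobovWeightSq α l)
      (g := fun l => korobovWeightSq α l * w l ^ 2 * x (shiftIdx hh hn l ξ) ^ 2 / freqNorm l ^ 7)
      (fun l _ => div_nonneg (pow_nonneg (freqNorm_nonneg _) _) (korobovWeightSq_pos α l).le)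
      (fun l hl => div_nonneg (hS0 l (Finset.mem_filter.1 hl).1)
        (pow_nonneg (freqNorm_nonneg _) _))
      (fun l hl => by
        have h1 : 0 < freqNorm l := by linarith [(Finset.mem_filter.1 hl).2]
        have h2 := korobovWeightSq_pos α l
        refine le_of_eq ?_
        field_simp)
    have h1 := sum_tail_freqNorm_pow_div_le hα F (X := μ / 2) (by positivity)
    rw [← hK] at h1
    have h2 : ∑ l ∈ F with μ / 2 ≤ freqNorm l,
        korobovWeightSq α l * w l ^ 2 * x (shiftIdx hh hn l ξ) ^ 2 / freqNorm l ^ 7 ≤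
        (∑ l ∈ F, korobovWeightSq α l * w l ^ 2 * x (shiftIdx hh hn l ξ) ^ 2) / (μ / 2) ^ 7 := by
      rw [Finset.sum_div]
      refine (Finset.sum_le_sum fun l hl => ?_).trans (Finset.sum_le_sum_of_subset_of_nonneg
        (Finset.filter_subset _ _) fun l hl _ => div_nonneg (hS0 l hl) (by positivity))
      have h3 := (Finset.mem_filter.1 hl).2
      have h4 := hS0 l (Finset.mem_filter.1 hl).1
      gcongr
    set S := ∑ l ∈ F, korobovWeightSq α l * w l ^ 2 * x (shiftIdx hh hn l ξ) ^ 2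
    have hS : 0 ≤ S := Finset.sum_nonneg hS0
    rw [mul_pow]
    calc (μ ^ 4) ^ 2 * (∑ l ∈ F with μ / 2 ≤ freqNorm l, w l * x (shiftIdx hh hn l ξ)) ^ 2
        ≤ (μ ^ 4) ^ 2 * (K / (μ / 2) * (S / (μ / 2) ^ 7)) := by
          refine mul_le_mul_of_nonneg_left (hcs.trans (mul_le_mul h1 h2 ?_ (by positivity)))
            (by positivity)
          exact Finset.sum_nonneg fun l hl => div_nonneg (hS0 l (Finset.mem_filter.1 hl).1)
            (pow_nonneg (freqNorm_nonneg _) _)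
      _ = 256 * K * S := by field_simp; ring
  rw [EuclideanSpace.norm_eq, EuclideanSpace.norm_eq, ← Real.sqrt_mul (by positivity)]
  refine Real.sqrt_le_sqrt ?_
  calc _ ≤ ∑ ξ, 256 * K * ∑ l ∈ F, korobovWeightSq α l * w l ^ 2 *
        x (shiftIdx hh hn l ξ) ^ 2 := Finset.sum_le_sum fun ξ _ => by
        rw [Real.norm_eq_abs, sq_abs]; exact hpt ξ
    _ = 256 * K * ((∑ l ∈ F, korobovWeightSq α l * w l ^ 2) * ∑ ξ, x ξ ^ 2) := by
        rw [← Finset.mul_sum, Finset.sum_comm, Finset.sum_mul]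
        congr 1
        refine Finset.sum_congr rfl fun l _ => ?_
        rw [← Finset.mul_sum, Equiv.sum_comp (shiftIdx hh hn l) fun ξ => x ξ ^ 2]
    _ ≤ 256 * K * (V * ∑ ξ, x ξ ^ 2) := by
        have := sum_mul_sq_le_of_korobov hv F
        gcongr
    _ = _ := by
        simp only [Real.norm_eq_abs, sq_abs]
        ring

/-- Bounds for `W_n` in a weighted norm follow from bounds for the partial sums of its expansion
into shifts. -/
lemma norm_mul_multMatrix_le (hα : 9 / 2 ≤ α) (hh : IsMinimalAntiAliasing Z n h)
    (hn : ∀ i, 0 < n i) (hv : IsKorobov α (toComplex v)) (a : MultiIndex n → ℝ)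
    (ha : ∀ ξ, 0 ≤ a ξ) (c : MultiIndex n → ℂ) {B : ℝ}
    (hB : ∀ F : Finset (Fin d → ℤ), ‖(WithLp.toLp 2 (fun ξ => ∑ l ∈ F, a ξ *
      (‖torusFourierCoeff (toComplex v) l‖ * ‖c (shiftIdx hh hn l ξ)‖)) :
        EuclideanSpace ℝ (MultiIndex n))‖ ≤ B) :
    ‖(WithLp.toLp 2 (fun ξ => (a ξ : ℂ) * (multMatrix Z n v).mulVec c ξ) :
      EuclideanSpace ℂ (MultiIndex n))‖ ≤ B := by
  have hs := summable_of_korobov hα hv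
  have ht : Filter.Tendsto (fun F : Finset (Fin d → ℤ) => (WithLp.toLp 2 (fun ξ => (a ξ : ℂ) *
      ∑ l ∈ F, torusFourierCoeff (toComplex v) l * c (shiftIdx hh hn l ξ)) :
        EuclideanSpace ℂ (MultiIndex n))) Filter.atTop
      (nhds (WithLp.toLp 2 (fun ξ => (a ξ : ℂ) * (multMatrix Z n v).mulVec c ξ))) := by
    refine ((PiLp.continuous_toLp 2 _).tendsto _).comp (tendsto_pi_nhds.2 fun ξ => ?_)
    exact (hh.hasSum_multMatrix_mulVec hn hs c ξ).const_mul _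
  refine le_of_tendsto ht.norm (Filter.Eventually.of_forall fun F => le_trans ?_ (hB F))
  refine norm_toLp_le_of_abs_le fun ξ => ?_
  rw [norm_mul, Complex.norm_of_nonneg (ha ξ), ← Finset.mul_sum]
  refine mul_le_mul_of_nonneg_left ((norm_sum_le _ _).trans ?_) (ha ξ)
  exact le_of_eq (Finset.sum_congr rfl fun l _ => norm_mul _ _)

/-- A bound for `∑_l (1 + ‖l‖₂²) |v̂(l)|`. -/
noncomputable def potentialMoment (α : ℝ) (v : C(Torus d, ℝ)) : ℝ :=
  (∑' l, ‖torusFourierCoeff (toComplex v) l‖ ^ 2 * korobovWeightSq α l) +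
    (1 + (d : ℝ) ^ 2) ^ 2 * 5 ^ d

/-- The bound of `norm_sum_large_le`. -/
noncomputable def potentialTail (α : ℝ) (v : C(Torus d, ℝ)) : ℝ :=
  √(256 * (d ^ 7 * (4 * d ^ 2 * 5 ^ d)) *
    (∑' l, ‖torusFourierCoeff (toComplex v) l‖ ^ 2 * korobovWeightSq α l))

lemma potentialMoment_nonneg (α : ℝ) (v : C(Torus d, ℝ)) : 0 ≤ potentialMoment α v :=
  add_nonneg (tsum_nonneg fun l => mul_nonneg (by positivity) (korobovWeightSq_pos α l).le)
    (by positivity)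

/-- The diagonal of `(γ/2) D_n + 1`. -/
noncomputable def shiftedEnergy (γ : ℝ) (h : MultiIndex n → Fin d → ℤ) (ξ : MultiIndex n) : ℝ :=
  1 + 2 * Real.pi ^ 2 * γ * freqNorm (h ξ) ^ 2

lemma one_le_shiftedEnergy {γ : ℝ} (hγ : 0 < γ) (ξ : MultiIndex n) :
    1 ≤ shiftedEnergy γ h ξ := by
  rw [shiftedEnergy, le_add_iff_nonneg_right]
  positivity

lemma norm_multMatrix_mulVec_le (hα : 9 / 2 ≤ α) (hh : IsMinimalAntiAliasing Z n h)
    (hn : ∀ i, 0 < n i) (hv : IsKorobov α (toComplex v)) (c : MultiIndex n → ℂ) :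
    ‖(WithLp.toLp 2 ((multMatrix Z n v).mulVec c) : EuclideanSpace ℂ (MultiIndex n))‖ ≤
      potentialMoment α v * ‖(WithLp.toLp 2 c : EuclideanSpace ℂ (MultiIndex n))‖ := by
  have h1 := norm_mul_multMatrix_le hα hh hn hv (fun _ => 1) (fun _ => zero_le_one) c
    (B := potentialMoment α v * ‖(WithLp.toLp 2 c : EuclideanSpace ℂ (MultiIndex n))‖)
    (fun F => by
      have h2 := norm_sum_perm_le F (fun l => ‖torusFourierCoeff (toComplex v) l‖)
        (fun _ => norm_nonneg _) (shiftIdx hh hn) (fun ξ => ‖c ξ‖)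
      have h3 : ‖(WithLp.toLp 2 (fun ξ => ‖c ξ‖) : EuclideanSpace ℝ (MultiIndex n))‖ =
          ‖(WithLp.toLp 2 c : EuclideanSpace ℂ (MultiIndex n))‖ := by
        simp [EuclideanSpace.norm_eq]
      rw [h3] at h2
      simp only [one_mul]
      refine h2.trans (mul_le_mul_of_nonneg_right ?_ (norm_nonneg _))
      refine (Finset.sum_le_sum fun l _ => ?_).trans (sum_one_add_freqNorm_sq_mul_le hα hv F)
      nlinarith [norm_nonneg (torusFourierCoeff (toComplex v) l), sq_nonneg (freqNorm l)])
  simpa using h1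

lemma norm_shiftedEnergy_mul_multMatrix_le {γ : ℝ} (hγ : 0 < γ) (hα : 9 / 2 ≤ α)
    (hh : IsMinimalAntiAliasing Z n h)
    (hn : ∀ i, 0 < n i) (hv : IsKorobov α (toComplex v)) (c : MultiIndex n → ℂ) :
    ‖(WithLp.toLp 2 (fun ξ => (shiftedEnergy γ h ξ : ℂ) * (multMatrix Z n v).mulVec c ξ) :
        EuclideanSpace ℂ (MultiIndex n))‖ ≤
      2 * (1 + 2 * Real.pi ^ 2 * γ) * potentialMoment α v *
        ‖(WithLp.toLp 2 (fun ξ => (shiftedEnergy γ h ξ : ℂ) * c ξ) :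
          EuclideanSpace ℂ (MultiIndex n))‖ := by
  have ha := fun ξ => zero_le_one.trans (one_le_shiftedEnergy (h := h) hγ ξ)
  refine norm_mul_multMatrix_le hα hh hn hv _ ha c fun F => ?_
  set κ := 2 * Real.pi ^ 2 * γ with hκ
  have hκ0 : 0 < κ := by positivity
  have h2 := norm_sum_perm_le F
    (fun l => 2 * (1 + κ) * ((1 + freqNorm l ^ 2) * ‖torusFourierCoeff (toComplex v) l‖))
    (fun l => by positivity) (shiftIdx hh hn) (fun ξ => shiftedEnergy γ h ξ * ‖c ξ‖)
  have h3 : ‖(WithLp.toLp 2 (fun ξ => shiftedEnergy γ h ξ * ‖c ξ‖) :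
      EuclideanSpace ℝ (MultiIndex n))‖ =
      ‖(WithLp.toLp 2 (fun ξ => (shiftedEnergy γ h ξ : ℂ) * c ξ) :
        EuclideanSpace ℂ (MultiIndex n))‖ := by
    simp [EuclideanSpace.norm_eq]
  rw [h3, ← Finset.mul_sum] at h2
  refine (norm_toLp_le_of_abs_le fun ξ => ?_).trans (h2.trans (mul_le_mul_of_nonneg_right
    (mul_le_mul_of_nonneg_left (sum_one_add_freqNorm_sq_mul_le hα hv F) (by positivity))
    (norm_nonneg _)))
  have h4 := ha ξ
  rw [Real.norm_of_nonneg (Finset.sum_nonneg fun l _ => by positivity)]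
  refine Finset.sum_le_sum fun l _ => ?_
  have h5 := freqNorm_le_shiftIdx hh hn l ξ
  set ξ' := shiftIdx hh hn l ξ
  have h6 : shiftedEnergy γ h ξ ≤ 2 * (1 + κ) * (1 + freqNorm l ^ 2) * shiftedEnergy γ h ξ' := by
    rw [shiftedEnergy, shiftedEnergy, ← hκ]
    have h7 : freqNorm (h ξ) ^ 2 ≤ 2 * freqNorm (h ξ') ^ 2 + 2 * freqNorm l ^ 2 := by
      have := pow_le_pow_left₀ (freqNorm_nonneg _) h5 2
      nlinarith [sq_nonneg (freqNorm (h ξ') - freqNorm l)]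
    have h8 : κ * freqNorm (h ξ) ^ 2 ≤ κ * (2 * freqNorm (h ξ') ^ 2 + 2 * freqNorm l ^ 2) := by
      gcongr
    have h9 : 0 ≤ κ * freqNorm (h ξ') ^ 2 := by positivity
    have h10 : 0 ≤ freqNorm l ^ 2 := by positivity
    nlinarith [mul_nonneg h9 h10, mul_nonneg hκ0.le h9, mul_nonneg hκ0.le (mul_nonneg h9 h10)]
  calc _ ≤ 2 * (1 + κ) * (1 + freqNorm l ^ 2) * shiftedEnergy γ h ξ' *
        (‖torusFourierCoeff (toComplex v) l‖ * ‖c ξ'‖) := by gcongr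
    _ = _ := by ring

/-- Multiplication by the potential is bounded in the discrete fourth-order Sobolev norm. -/
lemma norm_shiftedEnergy_sq_mul_multMatrix_le {γ : ℝ} (hγ : 0 < γ) (hα : 9 / 2 ≤ α)
    (hh : IsMinimalAntiAliasing Z n h)
    (hn : ∀ i, 0 < n i) (hv : IsKorobov α (toComplex v)) (c : MultiIndex n → ℂ) :
    ‖(WithLp.toLp 2 (fun ξ => ((shiftedEnergy γ h ξ ^ 2 : ℝ) : ℂ) *
        (multMatrix Z n v).mulVec c ξ) : EuclideanSpace ℂ (MultiIndex n))‖ ≤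
      (32 * potentialMoment α v + 2 * (2 * Real.pi ^ 2 * γ) ^ 2 * potentialTail α v) *
        ‖(WithLp.toLp 2 (fun ξ => ((shiftedEnergy γ h ξ ^ 2 : ℝ) : ℂ) * c ξ) :
          EuclideanSpace ℂ (MultiIndex n))‖ := by
  have ha := fun ξ => one_le_shiftedEnergy (h := h) hγ ξ
  refine norm_mul_multMatrix_le hα hh hn hv _ (fun ξ => sq_nonneg _) c fun F => ?_
  set κ := 2 * Real.pi ^ 2 * γ with hκ
  have hκ0 : 0 < κ := by positivity
  set w : (Fin d → ℤ) → ℝ := fun l => ‖torusFourierCoeff (toComplex v) l‖ with hw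
  set N := ‖(WithLp.toLp 2 (fun ξ => ((shiftedEnergy γ h ξ ^ 2 : ℝ) : ℂ) * c ξ) :
    EuclideanSpace ℂ (MultiIndex n))‖ with hN
  have h2 := norm_sum_perm_le F (fun l => 32 * w l)
    (fun l => by positivity) (shiftIdx hh hn) (fun ξ => shiftedEnergy γ h ξ ^ 2 * ‖c ξ‖)
  have h3 : ‖(WithLp.toLp 2 (fun ξ => shiftedEnergy γ h ξ ^ 2 * ‖c ξ‖) :
      EuclideanSpace ℝ (MultiIndex n))‖ = N := by
    simp [hN, EuclideanSpace.norm_eq]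
  rw [h3, ← Finset.mul_sum] at h2
  have hm : ∑ l ∈ F, w l ≤ potentialMoment α v :=
    (Finset.sum_le_sum fun l _ => by
      have : 0 ≤ w l := norm_nonneg _
      nlinarith [sq_nonneg (freqNorm l)]).trans (sum_one_add_freqNorm_sq_mul_le hα hv F)
  have h4 := norm_sum_large_le hα hh hn hv F (fun ξ => ‖c ξ‖)
  have h5 : ‖(WithLp.toLp 2 (fun ξ => ‖c ξ‖) : EuclideanSpace ℝ (MultiIndex n))‖ ≤ N := by
    rw [← h3]
    refine norm_toLp_le_of_abs_le fun ξ => ?_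
    rw [norm_norm]
    exact le_mul_of_one_le_left (norm_nonneg _) (one_le_pow₀ (ha ξ))
  have h6 : ∀ ξ, ‖∑ l ∈ F, shiftedEnergy γ h ξ ^ 2 * (w l * ‖c (shiftIdx hh hn l ξ)‖)‖ ≤
      (∑ l ∈ F, 32 * w l * (shiftedEnergy γ h (shiftIdx hh hn l ξ) ^ 2 *
        ‖c (shiftIdx hh hn l ξ)‖)) + 2 * κ ^ 2 * (freqNorm (h ξ) ^ 4 *
        ∑ l ∈ F with freqNorm (h ξ) / 2 ≤ freqNorm l, w l * ‖c (shiftIdx hh hn l ξ)‖) := by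
    intro ξ
    rw [Real.norm_of_nonneg (Finset.sum_nonneg fun l _ => by positivity), Finset.sum_filter,
      Finset.mul_sum, Finset.mul_sum, ← Finset.sum_add_distrib]
    refine Finset.sum_le_sum fun l _ => ?_
    have h7 := freqNorm_le_shiftIdx hh hn l ξ
    have h8 := ha (shiftIdx hh hn l ξ)
    set ξ' := shiftIdx hh hn l ξ
    have hy : 0 ≤ w l * ‖c ξ'‖ := mul_nonneg (norm_nonneg _) (norm_nonneg _)
    have h9 : shiftedEnergy γ h ξ ^ 2 ≤ 2 + 2 * κ ^ 2 * freqNorm (h ξ) ^ 4 := by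
      rw [shiftedEnergy, ← hκ]
      nlinarith [sq_nonneg (1 - κ * freqNorm (h ξ) ^ 2)]
    have h10 : 1 ≤ shiftedEnergy γ h ξ' ^ 2 := one_le_pow₀ h8
    split_ifs with hl
    · nlinarith [mul_nonneg (sub_nonneg.2 h9) hy, mul_nonneg (sub_nonneg.2 h10) hy]
    -- otherwise `‖l‖₂ < ‖h_ξ‖₂ / 2`, so the shifted frequency is at least half as large as `h_ξ`
    · have h11 : freqNorm (h ξ) ≤ 2 * freqNorm (h ξ') := by linarith
      have h12 : κ * freqNorm (h ξ) ^ 2 ≤ κ * (2 * freqNorm (h ξ')) ^ 2 := by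
        have := freqNorm_nonneg (h ξ)
        gcongr
      have h13 : shiftedEnergy γ h ξ ≤ 4 * shiftedEnergy γ h ξ' := by
        rw [shiftedEnergy, shiftedEnergy, ← hκ]
        nlinarith
      have h14 := pow_le_pow_left₀ (zero_le_one.trans (ha ξ)) h13 2
      nlinarith [mul_nonneg (sub_nonneg.2 h14) hy, mul_nonneg (sub_nonneg.2 h10) hy]
  refine (norm_toLp_le_of_abs_le h6).trans ?_
  have e : (WithLp.toLp 2 (fun ξ => (∑ l ∈ F, 32 * w l * (shiftedEnergy γ h
      (shiftIdx hh hn l ξ) ^ 2 * ‖c (shiftIdx hh hn l ξ)‖)) + 2 * κ ^ 2 * (freqNorm (h ξ) ^ 4 *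
        ∑ l ∈ F with freqNorm (h ξ) / 2 ≤ freqNorm l, w l * ‖c (shiftIdx hh hn l ξ)‖)) :
        EuclideanSpace ℝ (MultiIndex n)) =
      WithLp.toLp 2 (fun ξ => ∑ l ∈ F, 32 * w l * (shiftedEnergy γ h
        (shiftIdx hh hn l ξ) ^ 2 * ‖c (shiftIdx hh hn l ξ)‖)) +
      (2 * κ ^ 2) • WithLp.toLp 2 (fun ξ => freqNorm (h ξ) ^ 4 *
        ∑ l ∈ F with freqNorm (h ξ) / 2 ≤ freqNorm l, w l * ‖c (shiftIdx hh hn l ξ)‖) := by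
    ext ξ
    simp
  rw [e, add_mul]
  refine (norm_add_le _ _).trans (add_le_add (h2.trans ?_) ?_)
  · gcongr
  · rw [norm_smul, Real.norm_of_nonneg (by positivity), mul_assoc _ (potentialTail α v)]
    refine mul_le_mul_of_nonneg_left (h4.trans ?_) (by positivity)
    exact mul_le_mul_of_nonneg_left h5 (Real.sqrt_nonneg _)

/-! ### The discrete Hamiltonian -/

/-- The operator `D = (γ/2) D_n`. -/
noncomputable def kineticOp (γ : ℝ) (h : MultiIndex n → Fin d → ℤ) :
    EuclideanSpace ℂ (MultiIndex n) →L[ℂ] EuclideanSpace ℂ (MultiIndex n) :=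
  Matrix.toEuclideanCLM (𝕜 := ℂ) (((γ : ℂ) / 2) • laplaceMatrix h)

/-- The operator `W_n / γ`. -/
noncomputable def potentialOp (γ : ℝ) (Z : Matrix (Fin d) (Fin r) ℤ) (n : Fin r → ℕ)
    (v : C(Torus d, ℝ)) :
    EuclideanSpace ℂ (MultiIndex n) →L[ℂ] EuclideanSpace ℂ (MultiIndex n) :=
  Matrix.toEuclideanCLM (𝕜 := ℂ) ((γ : ℂ)⁻¹ • multMatrix Z n v)

lemma kineticOp_apply (γ : ℝ) (x : EuclideanSpace ℂ (MultiIndex n)) (ξ : MultiIndex n) :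
    kineticOp γ h x ξ = (2 * Real.pi ^ 2 * γ * freqNorm (h ξ) ^ 2 : ℝ) * x ξ := by
  rw [kineticOp, Matrix.ofLp_toEuclideanCLM, Matrix.smul_mulVec, Pi.smul_apply, laplaceMatrix,
    Matrix.mulVec_diagonal, smul_eq_mul]
  push_cast
  ring

lemma kineticOp_add_one_apply (γ : ℝ) (x : EuclideanSpace ℂ (MultiIndex n)) (ξ : MultiIndex n) :
    (kineticOp γ h + 1) x ξ = (shiftedEnergy γ h ξ : ℂ) * x ξ := by
  rw [add_apply, PiLp.add_apply, kineticOp_apply, shiftedEnergy, one_apply_eq_self]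
  push_cast
  ring

lemma shiftSq_kineticOp_apply (γ : ℝ) (x : EuclideanSpace ℂ (MultiIndex n)) (ξ : MultiIndex n) :
    shiftSq (kineticOp γ h) x ξ = ((shiftedEnergy γ h ξ ^ 2 : ℝ) : ℂ) * x ξ := by
  rw [shiftSq, pow_two, mul_apply_eq_comp, kineticOp_add_one_apply, kineticOp_add_one_apply]
  push_cast
  ring

lemma potentialOp_apply (γ : ℝ) (x : EuclideanSpace ℂ (MultiIndex n)) :
    potentialOp γ Z n v x =
      (γ : ℂ)⁻¹ • WithLp.toLp 2 ((multMatrix Z n v).mulVec (WithLp.ofLp x)) := by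
  rw [potentialOp, map_smul, smul_apply]
  rfl

/-- A bound for `W_n / γ` in each of the norms `‖x‖`, `‖(D + 1) x‖`, `‖(D + 1)² x‖` that does not
depend on the lattice. -/
noncomputable def splittingBound (γ α : ℝ) (v : C(Torus d, ℝ)) : ℝ :=
  γ⁻¹ * (2 * (1 + 2 * Real.pi ^ 2 * γ) * potentialMoment α v +
    (32 * potentialMoment α v + 2 * (2 * Real.pi ^ 2 * γ) ^ 2 * potentialTail α v))

lemma splittingBound_nonneg {γ : ℝ} (hγ : 0 < γ) (α : ℝ) (v : C(Torus d, ℝ)) :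
    0 ≤ splittingBound γ α v := by
  have hm := potentialMoment_nonneg α v
  have ht : 0 ≤ potentialTail α v := Real.sqrt_nonneg _
  rw [splittingBound]
  positivity

lemma isSelfAdjoint_kineticOp (γ : ℝ) : IsSelfAdjoint (kineticOp γ h) := by
  refine IsSelfAdjoint.map (f := Matrix.toEuclideanCLM (𝕜 := ℂ)) ?_
  rw [laplaceMatrix, ← Matrix.diagonal_smul]
  refine Matrix.isHermitian_diagonal_of_self_adjoint _ ?_
  ext ξ
  simp

lemma isSelfAdjoint_potentialOp (γ : ℝ) (hh : IsMinimalAntiAliasing Z n h)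
    (hn : ∀ i, 0 < n i) (v : C(Torus d, ℝ)) : IsSelfAdjoint (potentialOp γ Z n v) := by
  refine IsSelfAdjoint.map (f := Matrix.toEuclideanCLM (𝕜 := ℂ)) ?_
  refine IsSelfAdjoint.smul ?_ (hh.isHermitian_multMatrix hn v)
  rw [IsSelfAdjoint, star_inv₀, Complex.star_def, Complex.conj_ofReal]

lemma isSplitting_kineticOp_potentialOp {γ : ℝ} (hγ : 0 < γ) (hα : 9 / 2 ≤ α)
    (hh : IsMinimalAntiAliasing Z n h)
    (hn : ∀ i, 0 < n i) (hv : IsKorobov α (toComplex v)) :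
    IsSplitting (kineticOp γ h) (potentialOp γ Z n v) (splittingBound γ α v) := by
  have hm := potentialMoment_nonneg α v
  have ht : 0 ≤ potentialTail α v := Real.sqrt_nonneg _
  have hnorm : ‖(γ : ℂ)⁻¹‖ = γ⁻¹ := by
    rw [norm_inv, Complex.norm_of_nonneg hγ.le]
  have hmono : ∀ {a b c d : ℝ}, a ≤ c * b → c ≤ d → 0 ≤ b → γ⁻¹ * a ≤ γ⁻¹ * d * b :=
    fun {a b c d} h1 h2 h3 => by
      rw [mul_assoc]
      have := inv_nonneg.2 hγ.le
      exact mul_le_mul_of_nonneg_left (h1.trans (mul_le_mul_of_nonneg_right h2 h3)) this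
  have hA : ∀ x : EuclideanSpace ℂ (MultiIndex n), (kineticOp γ h + 1) x =
      WithLp.toLp 2 (fun ξ => (shiftedEnergy γ h ξ : ℂ) * x ξ) := fun x => by
    ext ξ; exact kineticOp_add_one_apply γ x ξ
  have hA2 : ∀ x : EuclideanSpace ℂ (MultiIndex n), shiftSq (kineticOp γ h) x =
      WithLp.toLp 2 (fun ξ => ((shiftedEnergy γ h ξ ^ 2 : ℝ) : ℂ) * x ξ) := fun x => by
    ext ξ; exact shiftSq_kineticOp_apply γ x ξ
  have hcmp : ∀ (x y : EuclideanSpace ℂ (MultiIndex n)), (∀ ξ, ‖x ξ‖ ≤ ‖y ξ‖) → ‖x‖ ≤ ‖y‖ := by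
    intro x y hxy
    rw [EuclideanSpace.norm_eq, EuclideanSpace.norm_eq]
    refine Real.sqrt_le_sqrt (Finset.sum_le_sum fun ξ _ => ?_)
    have := hxy ξ
    gcongr
  refine ⟨?_, ?_, ?_, ?_, ?_, ?_, ?_, ?_⟩
  · exact isSelfAdjoint_kineticOp γ
  · exact isSelfAdjoint_potentialOp γ hh hn v
  · exact splittingBound_nonneg hγ α v
  · refine fun x => hcmp _ _ fun ξ => ?_
    rw [kineticOp_add_one_apply, norm_mul, Complex.norm_of_nonneg
      (zero_le_one.trans (one_le_shiftedEnergy hγ ξ))]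
    exact le_mul_of_one_le_left (norm_nonneg _) (one_le_shiftedEnergy hγ ξ)
  · refine fun x => hcmp _ _ fun ξ => ?_
    rw [kineticOp_add_one_apply, kineticOp_apply, norm_mul, norm_mul, Complex.norm_of_nonneg
      (zero_le_one.trans (one_le_shiftedEnergy hγ ξ)), Complex.norm_of_nonneg (by positivity),
      shiftedEnergy]
    gcongr
    linarith
  · intro x
    rw [potentialOp_apply, norm_smul, hnorm]
    refine hmono (norm_multMatrix_mulVec_le hα hh hn hv x.ofLp) ?_ (norm_nonneg _)
    have : 0 ≤ 2 * (1 + 2 * Real.pi ^ 2 * γ) * potentialMoment α v := by positivity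
    have : 0 ≤ 2 * (2 * Real.pi ^ 2 * γ) ^ 2 * potentialTail α v := by positivity
    linarith
  · intro x
    rw [potentialOp_apply, map_smul, norm_smul, hnorm, hA, hA]
    refine hmono (norm_shiftedEnergy_mul_multMatrix_le hγ hα hh hn hv x.ofLp) ?_ (norm_nonneg _)
    have : 0 ≤ 32 * potentialMoment α v +
      2 * (2 * Real.pi ^ 2 * γ) ^ 2 * potentialTail α v := by positivity
    linarith
  · intro x
    rw [potentialOp_apply, map_smul, norm_smul, hnorm, hA2, hA2]
    refine hmono (norm_shiftedEnergy_sq_mul_multMatrix_le hγ hα hh hn hv x.ofLp) ?_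
      (norm_nonneg _)
    have : 0 ≤ 2 * (1 + 2 * Real.pi ^ 2 * γ) * potentialMoment α v := by positivity
    linarith

lemma graphNorm_eq (γ : ℝ) (c : MultiIndex n → ℂ) :
    graphNorm γ h c = ‖shiftSq (kineticOp γ h) (WithLp.toLp 2 c)‖ := by
  have e : shiftSq (kineticOp γ h) =
      Matrix.toEuclideanCLM (𝕜 := ℂ) ((((γ : ℂ) / 2) • laplaceMatrix h + 1) ^ 2) := by
    rw [map_pow, map_add, map_one]
    rfl
  rw [graphNorm, e, Matrix.toEuclideanCLM_toLp]

lemma toEuclideanCLM_exp (M : Matrix (MultiIndex n) (MultiIndex n) ℂ) :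
    Matrix.toEuclideanCLM (𝕜 := ℂ) (NormedSpace.exp M) =
      NormedSpace.exp (Matrix.toEuclideanCLM (𝕜 := ℂ) M) := by
  open scoped Matrix.Norms.L2Operator in
  let := NormedAlgebra.restrictScalars ℚ ℂ (Matrix (MultiIndex n) (MultiIndex n) ℂ)
  let := NormedAlgebra.restrictScalars ℚ ℂ
    (EuclideanSpace ℂ (MultiIndex n) →L[ℂ] EuclideanSpace ℂ (MultiIndex n))
  exact NormedSpace.map_exp (Matrix.toEuclideanCLM (𝕜 := ℂ))
    (AddMonoidHomClass.isometry_of_norm _ Matrix.l2_opNorm_toEuclideanCLM).continuous M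

lemma toEuclideanCLM_strangStep (γ τ : ℝ) (v : C(Torus d, ℝ)) :
    Matrix.toEuclideanCLM (𝕜 := ℂ) (strangStep γ τ Z n h v) =
      strangFlow (kineticOp γ h) (potentialOp γ Z n v) τ := by
  have e0 : ∀ A : EuclideanSpace ℂ (MultiIndex n) →L[ℂ] EuclideanSpace ℂ (MultiIndex n),
      τ • A = (τ : ℂ) • A := fun _ => rfl
  have e1 : Matrix.toEuclideanCLM (𝕜 := ℂ)
      ((-(Complex.I / (2 * (γ : ℂ))) * (τ : ℂ)) • multMatrix Z n v) =
      τ • (-(Complex.I / 2) • potentialOp γ Z n v) := by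
    rw [potentialOp, map_smul, map_smul, smul_smul, e0, smul_smul]
    congr 1
    ring
  have e2 : Matrix.toEuclideanCLM (𝕜 := ℂ)
      ((-(Complex.I * (γ : ℂ) / 2) * (τ : ℂ)) • laplaceMatrix h) =
      τ • (-Complex.I • kineticOp γ h) := by
    rw [kineticOp, map_smul, map_smul, smul_smul, e0, smul_smul]
    congr 1
    ring
  rw [strangStep, map_mul, map_mul, toEuclideanCLM_exp, toEuclideanCLM_exp, e1, e2, strangFlow]

lemma toLp_strangIterate (γ τ : ℝ) (v : C(Torus d, ℝ)) (g : C(Torus d, ℂ)) (k : ℕ) :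
    WithLp.toLp 2 (strangIterate γ τ Z n h v g k) =
      (strangFlow (kineticOp γ h) (potentialOp γ Z n v) τ ^ k) (sample Z n h g) := by
  induction k with
  | zero => rfl
  | succ k ih =>
    rw [strangIterate, pow_succ', mul_apply_eq_comp, ← ih, ← toEuclideanCLM_strangStep,
      Matrix.toEuclideanCLM_toLp]

end Multiplier

/-! ### The interpolation error -/

lemma normL2_le_enorm (f : C(Torus d, ℂ)) : normL2 f ≤ ‖f‖ₑ := by
  have h1 := eLpNorm_le_of_ae_bound (p := 2) (μ := torusMeasure d) (f := f) (C := ‖f‖)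
    (Filter.Eventually.of_forall fun x => f.norm_coe_le_norm x)
  rw [measure_univ, ENNReal.one_rpow, one_mul, ofReal_norm] at h1
  exact h1

lemma tsum_enorm_torusFourierCoeff_le (hi : Function.Injective h) (f : Torus d → ℂ) :
    ∑' l, ‖torusFourierCoeff f l‖ₑ ≤
      ∑ ξ, ‖torusFourierCoeff f (h ξ)‖ₑ + tailSum (Set.range h) f := by
  rw [← ENNReal.summable.tsum_add_tsum_compl (s := Set.range h) ENNReal.summable,
    tsum_range (fun l => ‖torusFourierCoeff f l‖ₑ) hi, tsum_fintype, tailSum]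
  simp only [ofReal_norm]
  rfl

lemma summable_of_tailSum_ne_top (hi : Function.Injective h) {f : Torus d → ℂ}
    (hf : tailSum (Set.range h) f ≠ ⊤) : Summable (torusFourierCoeff f) := by
  refine .of_enorm (ne_top_of_le_ne_top ?_ (tsum_enorm_torusFourierCoeff_le hi f))
  exact ENNReal.add_ne_top.2 ⟨(ENNReal.sum_lt_top.2 fun _ _ => enorm_lt_top).ne, hf⟩

lemma trigPoly_eq (c : EuclideanSpace ℂ (MultiIndex n)) :
    trigPoly h c.ofLp = (∑ ξ, (EuclideanSpace.proj ξ :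
      EuclideanSpace ℂ (MultiIndex n) →L[ℂ] ℂ).smulRight (mFourier (h ξ))) c := by
  simp [trigPoly]

lemma IsMinimalAntiAliasing.normL2_sub_interp_le (hh : IsMinimalAntiAliasing Z n h)
    (hn : ∀ i, 0 < n i) (f : C(Torus d, ℂ)) :
    normL2 (f - interp Z n h f : C(Torus d, ℂ)) ≤ 2 * tailSum (Set.range h) f := by
  rcases eq_or_ne (tailSum (Set.range h) f) ⊤ with htop | htop
  · simp [htop]
  have hs := summable_of_tailSum_ne_top (hh.injective hn) htop
  have h1 := hasSum_torusFourierCoeff hs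
  have h2 := (hh.hasSum_sample hn hs).mapL (∑ ξ, (EuclideanSpace.proj ξ :
    EuclideanSpace ℂ (MultiIndex n) →L[ℂ] ℂ).smulRight (mFourier (h ξ)))
  have h3 : ∀ l, (∑ ξ, (EuclideanSpace.proj ξ :
      EuclideanSpace ℂ (MultiIndex n) →L[ℂ] ℂ).smulRight (mFourier (h ξ)))
      (torusFourierCoeff f l • EuclideanSpace.single (residue Z hn l) (1 : ℂ)) =
      torusFourierCoeff f l • (mFourier (h (residue Z hn l)) : C(Torus d, ℂ)) := by
    intro l
    rw [map_smul]
    congr 1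
    simp
  simp only [h3] at h2
  rw [← trigPoly_eq] at h2
  have h4 := h1.sub h2
  rw [ofLp_sample] at h4
  change HasSum _ (f - interp Z n h f) at h4
  refine (normL2_le_enorm _).trans ?_
  rw [← h4.tsum_eq]
  refine (enorm_tsum_le_tsum_enorm (ε := C(Torus d, ℂ))).trans ?_
  rw [tailSum, tsum_subtype (Set.range h)ᶜ fun l => ENNReal.ofReal ‖torusFourierCoeff f l‖,
    ← ENNReal.tsum_mul_left]
  refine ENNReal.tsum_le_tsum fun l => ?_
  by_cases hl : l ∈ Set.range h
  · obtain ⟨ξ, rfl⟩ := hl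
    simp [hh.residue_apply hn]
  · have h5 : ∀ m : Fin d → ℤ, ‖(mFourier m : C(Torus d, ℂ))‖ₑ = 1 := fun m => by
      rw [← ofReal_norm, mFourier_norm, ENNReal.ofReal_one]
    rw [Set.indicator_of_mem (show l ∈ (Set.range h)ᶜ from hl), ofReal_norm, two_mul]
    refine enorm_sub_le.trans (le_of_eq ?_)
    rw [enorm_smul, enorm_smul, h5, h5, mul_one]

/-! ### The semidiscrete equation -/

lemma IsSemidiscreteSolution.hasDerivWithinAt {γ T : ℝ} (hγ : 0 < γ) {v : C(Torus d, ℝ)}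
    {g : C(Torus d, ℂ)} {U : ℝ → MultiIndex n → ℂ}
    (hU : IsSemidiscreteSolution γ T Z n h v g U) {t : ℝ} (ht : t ∈ Set.Icc 0 T) :
    HasDerivWithinAt (fun s => (WithLp.toLp 2 (U s) : EuclideanSpace ℂ (MultiIndex n)))
      (-Complex.I • (kineticOp γ h + potentialOp γ Z n v) (WithLp.toLp 2 (U t)))
      (Set.Icc 0 T) t := by
  have hγ' : (γ : ℂ) ≠ 0 := by exact_mod_cast hγ.ne'
  have h1 := (hU.equation t ht).const_smul (Complex.I * (γ : ℂ))⁻¹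
  have h2 := ((PiLp.continuousLinearEquiv 2 ℝ (fun _ : MultiIndex n => ℂ)).symm :
    (MultiIndex n → ℂ) →L[ℝ] EuclideanSpace ℂ (MultiIndex n)).hasFDerivAt.comp_hasDerivWithinAt
      t h1
  have e : ∀ s, (Complex.I * (γ : ℂ))⁻¹ • ((Complex.I * (γ : ℂ)) • U s) = U s := fun s =>
    inv_smul_smul₀ (mul_ne_zero Complex.I_ne_zero hγ') _
  refine (h2.congr_deriv ?_).congr_of_mem (fun s _ => ?_) ht
  · ext ξ
    have e1 : kineticOp γ h (WithLp.toLp 2 (U t)) ξ =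
        (γ : ℂ) / 2 * (laplaceMatrix h).mulVec (U t) ξ := by
      rw [kineticOp, Matrix.toEuclideanCLM_toLp, Matrix.smul_mulVec]
      rfl
    have e2 : potentialOp γ Z n v (WithLp.toLp 2 (U t)) ξ =
        (γ : ℂ)⁻¹ * (multMatrix Z n v).mulVec (U t) ξ := by
      rw [potentialOp_apply]
      rfl
    rw [add_apply, PiLp.smul_apply, PiLp.add_apply, e1, e2]
    change (Complex.I * (γ : ℂ))⁻¹ * ((γ : ℂ) ^ 2 / 2 * (laplaceMatrix h).mulVec (U t) ξ +
      (multMatrix Z n v).mulVec (U t) ξ) = _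
    rw [smul_eq_mul, mul_inv, Complex.inv_I]
    field_simp
  · exact (congrArg (WithLp.toLp 2) (e s)).symm

lemma IsMinimalAntiAliasing.one_le_freqNorm (hh : IsMinimalAntiAliasing Z n h)
    (hn : ∀ i, 0 < n i) {l : Fin d → ℤ} (hl : l ∉ Set.range h) : 1 ≤ freqNorm l := by
  have h0 : l ≠ 0 := by
    rintro rfl
    refine hl ⟨residue Z hn 0, ?_⟩
    have h1 := hh.minimal _ _ (mem_residueClass_residue hn 0)
    have h2 : freqNorm (0 : Fin d → ℤ) = 0 := by simp [freqNorm]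
    have h3 := le_antisymm (h1.trans h2.le) (freqNorm_nonneg _)
    rw [freqNorm_eq_norm, norm_eq_zero] at h3
    ext j
    have := congrArg (fun x : EuclideanSpace ℝ (Fin d) => x j) h3
    simpa using this
  obtain ⟨j, hj⟩ := Function.ne_iff.1 h0
  refine Real.one_le_sqrt.2 ?_
  have h1 : (1 : ℝ) ≤ (l j : ℝ) ^ 2 := by
    have hj' : l j ≠ 0 := hj
    have : 0 < (l j) ^ 2 := by positivity
    exact_mod_cast this
  exact h1.trans (Finset.single_le_sum (f := fun j => (l j : ℝ) ^ 2)
    (fun i _ => sq_nonneg _) (Finset.mem_univ j))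

lemma IsMinimalAntiAliasing.tailSum_le_weightedTailSum (hh : IsMinimalAntiAliasing Z n h)
    (hn : ∀ i, 0 < n i) (f : Torus d → ℂ) :
    tailSum (Set.range h) f ≤ weightedTailSum (Set.range h) f := by
  refine ENNReal.tsum_le_tsum fun l => ENNReal.ofReal_le_ofReal ?_
  exact le_mul_of_one_le_left (norm_nonneg _) (one_le_pow₀ (hh.one_le_freqNorm hn l.2))

lemma norm_sum_smul_single_le {ι κ : Type*} [Fintype ι] [DecidableEq ι] (F : Finset κ)
    (a : κ → ℂ) (σ : κ → ι) :
    ‖∑ l ∈ F, a l • (EuclideanSpace.single (σ l) (1 : ℂ))‖ ≤ ∑ l ∈ F, ‖a l‖ := by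
  refine (norm_sum_le _ _).trans (le_of_eq (Finset.sum_congr rfl fun l _ => ?_))
  rw [norm_smul, PiLp.norm_single, norm_one, mul_one]

lemma kineticOp_single (γ : ℝ) (ξ : MultiIndex n) :
    kineticOp γ h (EuclideanSpace.single ξ 1) =
      ((2 * Real.pi ^ 2 * γ * freqNorm (h ξ) ^ 2 : ℝ) : ℂ) • EuclideanSpace.single ξ 1 := by
  ext ζ
  rw [kineticOp_apply, PiLp.smul_apply, smul_eq_mul, PiLp.single_apply]
  split_ifs with hζ
  · rw [hζ]
  · simp

/-! ### The aliasing error -/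

section Aliased

variable {γ T : ℝ} {v : C(Torus d, ℝ)} {g : C(Torus d, ℂ)} {u : ℝ → C(Torus d, ℂ)}

/-- The samples of `f` restricted to the frequencies in a finite set `F`: the sum of
`f̂(l) e_{ξ(l)}` over `l ∈ F`, where `ξ(l)` is the residue of `l`. -/
noncomputable def partialSample (Z : Matrix (Fin d) (Fin r) ℤ) (hn : ∀ i, 0 < n i)
    (F : Finset (Fin d → ℤ)) (f : Torus d → ℂ) : EuclideanSpace ℂ (MultiIndex n) :=
  ∑ l ∈ F, torusFourierCoeff f l • EuclideanSpace.single (residue Z hn l) (1 : ℂ)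

/-- The forcing caused by the difference between `‖l‖₂²` and `‖h_ξ‖₂²` for aliased `l`. -/
noncomputable def aliasForcing (γ : ℝ) (Z : Matrix (Fin d) (Fin r) ℤ) (hn : ∀ i, 0 < n i)
    (h : MultiIndex n → Fin d → ℤ) (F : Finset (Fin d → ℤ)) (f : Torus d → ℂ) :
    EuclideanSpace ℂ (MultiIndex n) :=
  ∑ l ∈ F, (((2 * Real.pi ^ 2 * γ * (freqNorm l ^ 2 - freqNorm (h (residue Z hn l)) ^ 2) : ℝ) : ℂ) *
    torusFourierCoeff f l) • EuclideanSpace.single (residue Z hn l) (1 : ℂ)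

/-- The forcing caused by the truncation to `F`, which vanishes in the limit. -/
noncomputable def truncForcing (γ : ℝ) (Z : Matrix (Fin d) (Fin r) ℤ) (hn : ∀ i, 0 < n i)
    (v : C(Torus d, ℝ)) (F : Finset (Fin d → ℤ)) (f : C(Torus d, ℂ)) :
    EuclideanSpace ℂ (MultiIndex n) :=
  (γ : ℂ)⁻¹ • partialSample Z hn F (toComplex v * f : C(Torus d, ℂ)) -
    potentialOp γ Z n v (partialSample Z hn F f)

lemma hasDerivWithinAt_partialSample (hγ : 0 < γ) (hn : ∀ i, 0 < n i)
    (hu : IsSolution γ T v g u) (F : Finset (Fin d → ℤ)) {t : ℝ} (ht : t ∈ Set.Icc 0 T) :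
    HasDerivWithinAt (fun s => partialSample Z hn F (u s))
      (-Complex.I • (kineticOp γ h + potentialOp γ Z n v) (partialSample Z hn F (u t)) +
        -Complex.I • (aliasForcing γ Z hn h F (u t) + truncForcing γ Z hn v F (u t)))
      (Set.Icc 0 T) t := by
  have h1 := HasDerivWithinAt.fun_sum (u := F) fun l _ =>
    (hu.hasDerivWithinAt_coeff hγ l ht).smul_const
      (EuclideanSpace.single (residue Z hn l) (1 : ℂ))
  refine h1.congr_deriv ?_
  rw [truncForcing, add_apply]
  have e1 : kineticOp γ h (partialSample Z hn F (u t)) + aliasForcing γ Z hn h F (u t) =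
      ∑ l ∈ F, ((2 * Real.pi ^ 2 * γ * freqNorm l ^ 2 : ℝ) * torusFourierCoeff (u t) l) •
        EuclideanSpace.single (residue Z hn l) (1 : ℂ) := by
    rw [partialSample, aliasForcing, map_sum, ← Finset.sum_add_distrib]
    refine Finset.sum_congr rfl fun l _ => ?_
    rw [map_smul, kineticOp_single, smul_smul, ← add_smul]
    congr 1
    push_cast
    ring
  have e2 : ∑ l ∈ F, (-Complex.I * ((2 * Real.pi ^ 2 * γ * freqNorm l ^ 2 : ℝ) *
      torusFourierCoeff (u t) l +
        (γ : ℂ)⁻¹ * torusFourierCoeff (toComplex v * u t : C(Torus d, ℂ)) l)) •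
      EuclideanSpace.single (residue Z hn l) (1 : ℂ) =
      -Complex.I • ((kineticOp γ h (partialSample Z hn F (u t)) + aliasForcing γ Z hn h F (u t)) +
        (γ : ℂ)⁻¹ • partialSample Z hn F (toComplex v * u t : C(Torus d, ℂ))) := by
    rw [e1, partialSample, Finset.smul_sum, ← Finset.sum_add_distrib, Finset.smul_sum]
    refine Finset.sum_congr rfl fun l _ => ?_
    rw [smul_smul, ← add_smul, smul_smul]
  refine (e2.trans ?_)
  module

lemma continuousOn_aliasForcing (hn : ∀ i, 0 < n i) (hu : IsSolution γ T v g u)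
    (F : Finset (Fin d → ℤ)) :
    ContinuousOn (fun s => aliasForcing γ Z hn h F (u s)) (Set.Icc 0 T) := by
  refine continuousOn_finsetSum _ fun l _ => ?_
  have := hu.continuousOn_coeff_mul 1 l
  simp only [one_mul] at this
  exact (continuousOn_const.mul this).smul continuousOn_const

lemma continuousOn_partialSample_mul (hn : ∀ i, 0 < n i) (hu : IsSolution γ T v g u)
    (w : C(Torus d, ℂ)) (F : Finset (Fin d → ℤ)) :
    ContinuousOn (fun s => partialSample Z hn F (w * u s : C(Torus d, ℂ))) (Set.Icc 0 T) :=
  continuousOn_finsetSum _ fun l _ => (hu.continuousOn_coeff_mul w l).smul continuousOn_const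

lemma continuousOn_truncForcing (hn : ∀ i, 0 < n i) (hu : IsSolution γ T v g u)
    (F : Finset (Fin d → ℤ)) :
    ContinuousOn (fun s => truncForcing γ Z hn v F (u s)) (Set.Icc 0 T) := by
  have h1 := continuousOn_partialSample_mul (Z := Z) hn hu 1 F
  simp only [one_mul] at h1
  have h2 : ContinuousOn (fun s => potentialOp γ Z n v (partialSample Z hn F (u s)))
      (Set.Icc 0 T) := (potentialOp γ Z n v).continuous.comp_continuousOn h1
  have h3 : ContinuousOn (fun s => (γ : ℂ)⁻¹ •
      partialSample Z hn F (toComplex v * u s : C(Torus d, ℂ))) (Set.Icc 0 T) :=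
    ContinuousOn.fun_smul continuousOn_const (continuousOn_partialSample_mul hn hu (toComplex v) F)
  exact ContinuousOn.fun_sub h3 h2

/-- Only frequencies outside the anti-aliasing set contribute to the forcing. -/
lemma norm_aliasForcing_le (hγ : 0 < γ) (hh : IsMinimalAntiAliasing Z n h)
    (hn : ∀ i, 0 < n i) (F : Finset (Fin d → ℤ)) {f : Torus d → ℂ} {M : ℝ} (hM : 0 ≤ M)
    (hf : weightedTailSum (Set.range h) f ≤ ENNReal.ofReal M) :
    ‖aliasForcing γ Z hn h F f‖ ≤ 2 * Real.pi ^ 2 * γ * M := by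
  classical
  refine (norm_sum_smul_single_le F _ _).trans ?_
  have h1 : ∀ l ∈ F, ‖((2 * Real.pi ^ 2 * γ * (freqNorm l ^ 2 -
      freqNorm (h (residue Z hn l)) ^ 2) : ℝ) : ℂ) * torusFourierCoeff f l‖ ≤
      2 * Real.pi ^ 2 * γ * ((Set.range h)ᶜ.indicator
        (fun l => freqNorm l ^ 2 * ‖torusFourierCoeff f l‖) l) := by
    intro l _
    by_cases hl : l ∈ Set.range h
    · obtain ⟨ξ, rfl⟩ := hl
      simp [hh.residue_apply hn]
    · have h2 := hh.minimal _ _ (mem_residueClass_residue hn l)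
      have h3 := pow_le_pow_left₀ (freqNorm_nonneg _) h2 2
      rw [Set.indicator_of_mem (show l ∈ (Set.range h)ᶜ from hl), norm_mul,
        Complex.norm_of_nonneg (mul_nonneg (by positivity) (sub_nonneg.2 h3)), mul_assoc]
      gcongr
      exact sub_le_self _ (sq_nonneg _)
  refine (Finset.sum_le_sum h1).trans ?_
  rw [← Finset.mul_sum]
  refine mul_le_mul_of_nonneg_left ?_ (by positivity)
  have h4 : ∀ l, 0 ≤ (Set.range h)ᶜ.indicator
      (fun l => freqNorm l ^ 2 * ‖torusFourierCoeff f l‖) l := fun l =>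
    Set.indicator_nonneg (fun _ _ => by positivity) l
  rw [← ENNReal.ofReal_le_ofReal_iff hM, ENNReal.ofReal_sum_of_nonneg fun l _ => h4 l]
  refine (ENNReal.sum_le_tsum F).trans (le_trans (le_of_eq ?_) hf)
  rw [weightedTailSum, tsum_subtype (Set.range h)ᶜ fun l =>
    ENNReal.ofReal (freqNorm l ^ 2 * ‖torusFourierCoeff f l‖)]
  refine tsum_congr fun l => ?_
  by_cases hl : l ∈ (Set.range h)ᶜ
  · rw [Set.indicator_of_mem hl, Set.indicator_of_mem hl]
  · rw [Set.indicator_of_notMem hl, Set.indicator_of_notMem hl, ENNReal.ofReal_zero]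

lemma tendsto_partialSample (hh : IsMinimalAntiAliasing Z n h) (hn : ∀ i, 0 < n i)
    {f : C(Torus d, ℂ)} (hf : Summable (torusFourierCoeff f)) :
    Filter.Tendsto (fun F => partialSample Z hn F f) Filter.atTop (nhds (sample Z n h f)) :=
  hh.hasSum_sample hn hf

lemma tendsto_truncForcing (hh : IsMinimalAntiAliasing Z n h) (hn : ∀ i, 0 < n i)
    (hv : Summable (torusFourierCoeff (toComplex v))) {f : C(Torus d, ℂ)}
    (hf : Summable (torusFourierCoeff f)) :
    Filter.Tendsto (fun F => truncForcing γ Z hn v F f) Filter.atTop (nhds 0) := by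
  have h1 := ((tendsto_partialSample hh hn (summable_torusFourierCoeff_mul hv hf)).const_smul
    (γ : ℂ)⁻¹).sub (((potentialOp γ Z n v).continuous.tendsto _).comp
      (tendsto_partialSample hh hn hf))
  have e : (γ : ℂ)⁻¹ • sample Z n h (toComplex v * f) -
      potentialOp γ Z n v (sample Z n h f) = 0 := by
    rw [potentialOp_apply, ofLp_sample, hh.multMatrix_mulVec hn]
    exact sub_self _
  rw [e] at h1
  exact h1

lemma norm_partialSample_le (hn : ∀ i, 0 < n i) (F : Finset (Fin d → ℤ)) {f : Torus d → ℂ}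
    {K : ℝ} (hK : 0 ≤ K) (hf : ∑' l, ‖torusFourierCoeff f l‖ₑ ≤ ENNReal.ofReal K) :
    ‖partialSample Z hn F f‖ ≤ K := by
  refine (norm_sum_smul_single_le F _ _).trans ?_
  rw [← ENNReal.ofReal_le_ofReal_iff hK, ENNReal.ofReal_sum_of_nonneg fun l _ => norm_nonneg _]
  simp only [ofReal_norm]
  exact (ENNReal.sum_le_tsum F).trans hf

lemma norm_truncForcing_le (hn : ∀ i, 0 < n i)
    (hv : Summable (torusFourierCoeff (toComplex v))) (F : Finset (Fin d → ℤ))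
    {f : C(Torus d, ℂ)} {K : ℝ} (hK : 0 ≤ K)
    (hf : ∑' l, ‖torusFourierCoeff f l‖ₑ ≤ ENNReal.ofReal K) :
    ‖truncForcing γ Z hn v F f‖ ≤
      ‖(γ : ℂ)⁻¹‖ * ((∑' l, ‖torusFourierCoeff (toComplex v) l‖) * K) +
        ‖potentialOp γ Z n v‖ * K := by
  have hV : 0 ≤ ∑' l, ‖torusFourierCoeff (toComplex v) l‖ := tsum_nonneg fun _ => norm_nonneg _
  have h1 : ∑' l, ‖torusFourierCoeff (toComplex v * f : C(Torus d, ℂ)) l‖ₑ ≤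
      ENNReal.ofReal ((∑' l, ‖torusFourierCoeff (toComplex v) l‖) * K) := by
    refine (tsum_enorm_torusFourierCoeff_mul_le _
      (.of_enorm (ne_top_of_le_ne_top ENNReal.ofReal_ne_top hf))).trans ?_
    rw [ENNReal.ofReal_mul hV, ENNReal.ofReal_tsum_of_nonneg (fun _ => norm_nonneg _) hv.norm]
    simp only [ofReal_norm]
    gcongr
  refine (norm_sub_le _ _).trans (add_le_add ?_ ?_)
  · rw [norm_smul]
    gcongr
    exact norm_partialSample_le hn F (mul_nonneg hV hK) h1
  · refine (ContinuousLinearMap.le_opNorm _ _).trans ?_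
    gcongr
    exact norm_partialSample_le hn F hK hf

/-- The samples of the exact solution stay close to the semidiscrete solution. Duhamel's estimate is
applied to the samples truncated to finitely many frequencies, which are differentiable in time;
then the truncation is removed by dominated convergence. -/
lemma norm_sample_sub_le (hγ : 0 < γ) (hh : IsMinimalAntiAliasing Z n h)
    (hn : ∀ i, 0 < n i) (hv : Summable (torusFourierCoeff (toComplex v)))
    (hu : IsSolution γ T v g u) {U : ℝ → MultiIndex n → ℂ}
    (hU : IsSemidiscreteSolution γ T Z n h v g U) {t M : ℝ} (ht : 0 ≤ t) (htT : t ≤ T)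
    (hM : 0 ≤ M)
    (hMs : ∀ s ∈ Set.Icc 0 t, weightedTailSum (Set.range h) (u s) ≤ ENNReal.ofReal M) :
    ‖sample Z n h (u t) - WithLp.toLp 2 (U t)‖ ≤ 2 * Real.pi ^ 2 * γ * M * t := by
  have hsub : Set.Icc 0 t ⊆ Set.Icc 0 T := Set.Icc_subset_Icc_right htT
  have h0T : (0 : ℝ) ∈ Set.Icc 0 t := ⟨le_rfl, ht⟩
  have htt : t ∈ Set.Icc 0 t := ⟨ht, le_rfl⟩
  have htail : ∀ s ∈ Set.Icc 0 t, tailSum (Set.range h) (u s) ≤ ENNReal.ofReal M := fun s hs =>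
    (hh.tailSum_le_weightedTailSum hn _).trans (hMs s hs)
  have hsum : ∀ s ∈ Set.Icc 0 t, Summable (torusFourierCoeff (u s)) := fun s hs =>
    summable_of_tailSum_ne_top (hh.injective hn)
      (ne_top_of_le_ne_top ENNReal.ofReal_ne_top (htail s hs))
  -- a bound on the Wiener norms of `u s` that is uniform in time, for dominated convergence
  obtain ⟨K, hK0, hK⟩ : ∃ K : ℝ, 0 ≤ K ∧ ∀ s ∈ Set.Icc 0 t,
      ∑' l, ‖torusFourierCoeff (u s) l‖ₑ ≤ ENNReal.ofReal K := by
    have hc : ContinuousOn (fun s => ∑ ξ, ‖torusFourierCoeff (u s) (h ξ)‖) (Set.Icc 0 t) := by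
      refine continuousOn_finsetSum _ fun ξ _ => ?_
      have := hu.continuousOn_coeff_mul 1 (h ξ)
      simp only [one_mul] at this
      exact (this.mono hsub).norm
    obtain ⟨C, hC⟩ := isCompact_Icc.exists_bound_of_continuousOn hc
    have hC0 : 0 ≤ C := (norm_nonneg _).trans (hC 0 h0T)
    refine ⟨C + M, by positivity, fun s hs => ?_⟩
    refine (tsum_enorm_torusFourierCoeff_le (hh.injective hn) (u s)).trans ?_
    rw [ENNReal.ofReal_add hC0 hM]
    refine add_le_add ?_ (htail s hs)
    have := ENNReal.ofReal_le_ofReal ((Real.le_norm_self _).trans (hC s hs))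
    rw [ENNReal.ofReal_sum_of_nonneg fun _ _ => norm_nonneg _] at this
    simpa only [ofReal_norm] using this
  set κ := 2 * Real.pi ^ 2 * γ * M with hκ
  have hself : IsSelfAdjoint (kineticOp γ h + potentialOp γ Z n v) :=
    IsSelfAdjoint.add (R := EuclideanSpace ℂ (MultiIndex n) →L[ℂ] EuclideanSpace ℂ (MultiIndex n))
      (isSelfAdjoint_kineticOp γ) (isSelfAdjoint_potentialOp γ hh hn v)
  have hF : ∀ F : Finset (Fin d → ℤ), ‖partialSample Z hn F (u t) - WithLp.toLp 2 (U t)‖ ≤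
      ‖partialSample Z hn F (u 0) - WithLp.toLp 2 (U 0)‖ +
        (κ * t + ∫ s in (0 : ℝ)..t, ‖truncForcing γ Z hn v F (u s)‖) := by
    intro F
    have hcA := (continuousOn_aliasForcing (Z := Z) (h := h) hn hu F).mono hsub
    have hcT := (continuousOn_truncForcing (Z := Z) hn hu F).mono hsub
    have hcF : ContinuousOn (fun s => -Complex.I •
        (aliasForcing γ Z hn h F (u s) + truncForcing γ Z hn v F (u s))) (Set.Icc 0 t) :=
      ContinuousOn.fun_smul continuousOn_const (ContinuousOn.fun_add hcA hcT)
    have hd := norm_le_add_integral_of_hasDerivWithinAt hself ht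
      (e := fun s => partialSample Z hn F (u s) - WithLp.toLp 2 (U s))
      (f := fun s => -Complex.I • (aliasForcing γ Z hn h F (u s) + truncForcing γ Z hn v F (u s)))
      (fun s hs => (((hasDerivWithinAt_partialSample hγ hn hu F (hsub hs)).sub
        (hU.hasDerivWithinAt hγ (hsub hs))).mono hsub).congr_deriv (by
          rw [map_sub]
          module))
      hcF
    refine hd.trans (add_le_add le_rfl ?_)
    have hiT : IntervalIntegrable (fun s => ‖truncForcing γ Z hn v F (u s)‖) volume 0 t :=
      ContinuousOn.intervalIntegrable (by rw [Set.uIcc_of_le ht]; exact hcT.norm)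
    have e : κ * t + ∫ s in (0 : ℝ)..t, ‖truncForcing γ Z hn v F (u s)‖ =
        ∫ s in (0 : ℝ)..t, (κ + ‖truncForcing γ Z hn v F (u s)‖) := by
      rw [intervalIntegral.integral_add intervalIntegrable_const hiT]
      simp [mul_comm]
    rw [e]
    refine intervalIntegral.integral_mono_on ht ?_ (intervalIntegrable_const.add hiT)
      fun s hs => ?_
    · refine ContinuousOn.intervalIntegrable ?_
      rw [Set.uIcc_of_le ht]
      exact hcF.norm
    · rw [norm_smul, norm_neg, Complex.norm_I, one_mul]
      exact (norm_add_le _ _).trans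
        (add_le_add (norm_aliasForcing_le hγ hh hn F hM (hMs s hs)) le_rfl)
  have hlim : Filter.Tendsto (fun F : Finset (Fin d → ℤ) =>
      ∫ s in (0 : ℝ)..t, ‖truncForcing γ Z hn v F (u s)‖) Filter.atTop (nhds 0) := by
    have := intervalIntegral.tendsto_integral_filter_of_dominated_convergence
      (μ := volume) (a := 0) (b := t) (l := (Filter.atTop : Filter (Finset (Fin d → ℤ))))
      (F := fun F s => ‖truncForcing γ Z hn v F (u s)‖) (f := fun _ => 0)
      (fun _ => ‖(γ : ℂ)⁻¹‖ * ((∑' l, ‖torusFourierCoeff (toComplex v) l‖) * K) +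
        ‖potentialOp γ Z n v‖ * K)
      (Filter.Eventually.of_forall fun F => by
        rw [Set.uIoc_of_le ht]
        exact (((continuousOn_truncForcing hn hu F).mono
          (Set.Ioc_subset_Icc_self.trans hsub)).norm).aestronglyMeasurable measurableSet_Ioc)
      (Filter.Eventually.of_forall fun F => Filter.Eventually.of_forall fun s hs => by
        rw [Set.uIoc_of_le ht] at hs
        rw [norm_norm]
        exact norm_truncForcing_le hn hv F hK0 (hK s (Set.Ioc_subset_Icc_self hs)))
      intervalIntegrable_const
      (Filter.Eventually.of_forall fun s hs => by
        rw [Set.uIoc_of_le ht] at hs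
        have := (tendsto_truncForcing (γ := γ) hh hn hv
          (hsum s (Set.Ioc_subset_Icc_self hs))).norm
        rwa [norm_zero] at this)
    simpa using this
  have hU0 : WithLp.toLp 2 (U 0) = sample Z n h (u 0) := by
    rw [hU.initial, hu.initial]
    rfl
  have h1 := ((tendsto_partialSample hh hn (hsum t htt)).sub_const (WithLp.toLp 2 (U t))).norm
  have h2 := ((tendsto_partialSample hh hn (hsum 0 h0T)).sub_const (WithLp.toLp 2 (U 0))).norm
  have h3 := le_of_tendsto_of_tendsto' h1 (h2.add (tendsto_const_nhds.add hlim)) hF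
  rw [hU0, sub_self, norm_zero] at h3
  linarith

end Aliased

/-! ### The three parts of the total error -/

lemma normL2_sub_le_add_add (f₀ f₁ f₂ f₃ : C(Torus d, ℂ)) :
    normL2 (f₀ - f₃ : C(Torus d, ℂ)) ≤ normL2 (f₀ - f₁ : C(Torus d, ℂ)) +
      normL2 (f₁ - f₂ : C(Torus d, ℂ)) + normL2 (f₂ - f₃ : C(Torus d, ℂ)) := by
  have key : ∀ f g : C(Torus d, ℂ), normL2 (f + g : C(Torus d, ℂ)) ≤ normL2 f + normL2 g :=
    fun f g => eLpNorm_add_le f.continuous.aestronglyMeasurable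
      g.continuous.aestronglyMeasurable one_le_two
  have e : f₀ - f₃ = (f₀ - f₁) + (f₁ - f₂) + (f₂ - f₃) := by abel
  rw [e]
  exact (key _ _).trans (add_le_add (key _ _) le_rfl)

lemma IsMinimalAntiAliasing.normL2_trigPoly_sub (hh : IsMinimalAntiAliasing Z n h)
    (hn : ∀ i, 0 < n i) (c c' : MultiIndex n → ℂ) :
    normL2 (trigPoly h c - trigPoly h c' : C(Torus d, ℂ)) =
      ‖(WithLp.toLp 2 c - WithLp.toLp 2 c' : EuclideanSpace ℂ (MultiIndex n))‖ₑ := by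
  have e : trigPoly h c - trigPoly h c' = trigPoly h (c - c') := by
    have h1 := map_sub (∑ ξ, (EuclideanSpace.proj ξ :
      EuclideanSpace ℂ (MultiIndex n) →L[ℂ] ℂ).smulRight (mFourier (h ξ)))
      (WithLp.toLp 2 c) (WithLp.toLp 2 c')
    rw [← trigPoly_eq, ← trigPoly_eq, ← trigPoly_eq] at h1
    exact h1.symm
  rw [e, hh.normL2_trigPoly hn]
  rfl

/-- A bound `b M` valid for every finite `M ≥ F s` yields the bound by the supremum of `F`, also
when that supremum is infinite. -/
lemma enorm_le_ofReal_mul_iSup {E ι : Type*} [NormedAddCommGroup E] {x : E} {S : Set ι}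
    {F : ι → ℝ≥0∞} {b : ℝ} (hb : 0 < b)
    (hx : ∀ M : ℝ, 0 ≤ M → (∀ s ∈ S, F s ≤ ENNReal.ofReal M) → ‖x‖ ≤ b * M) :
    ‖x‖ₑ ≤ ENNReal.ofReal b * ⨆ s ∈ S, F s := by
  rcases eq_or_ne (⨆ s ∈ S, F s) ⊤ with htop | htop
  · rw [htop, ENNReal.mul_top (ENNReal.ofReal_pos.2 hb).ne']
    exact le_top
  · rw [← ENNReal.ofReal_toReal htop, ← ENNReal.ofReal_mul hb.le, ← ofReal_norm]
    refine ENNReal.ofReal_le_ofReal (hx _ ENNReal.toReal_nonneg fun s hs => ?_)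
    rw [ENNReal.ofReal_toReal htop]
    exact le_iSup₂ (f := fun s _ => F s) s hs

section Errors

variable {γ T : ℝ} {v : C(Torus d, ℝ)} {g : C(Torus d, ℂ)} {u : ℝ → C(Torus d, ℂ)}
  {U : ℝ → MultiIndex n → ℂ}

lemma normL2_interp_sub_trigPoly_le (hγ : 0 < γ) (hh : IsMinimalAntiAliasing Z n h)
    (hn : ∀ i, 0 < n i) (hv : Summable (torusFourierCoeff (toComplex v)))
    (hu : IsSolution γ T v g u) (hU : IsSemidiscreteSolution γ T Z n h v g U) {t : ℝ}
    (ht : 0 ≤ t) (htT : t ≤ T) :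
    normL2 (interp Z n h (u t) - trigPoly h (U t) : C(Torus d, ℂ)) ≤
      ENNReal.ofReal (4 * Real.pi ^ 2 * (t * γ / 2)) *
        ⨆ s ∈ Set.Icc (0 : ℝ) t, weightedTailSum (Set.range h) (u s) := by
  rw [interp, hh.normL2_trigPoly_sub hn]
  rcases ht.eq_or_lt with rfl | ht'
  · rw [hU.initial, hu.initial, sub_self, enorm_zero]
    exact zero_le
  · refine enorm_le_ofReal_mul_iSup (by positivity) fun M hM hMs => ?_
    refine (norm_sample_sub_le hγ hh hn hv hu hU ht htT hM hMs).trans (le_of_eq ?_)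
    ring

lemma normL2_trigPoly_sub_strangIterate_le (hγ : 0 < γ) {α : ℝ} (hα : 9 / 2 ≤ α)
    (hh : IsMinimalAntiAliasing Z n h) (hn : ∀ i, 0 < n i) (hv : IsKorobov α (toComplex v))
    (hU : IsSemidiscreteSolution γ T Z n h v g U) {τ : ℝ} (hτ : 0 < τ) (k : ℕ)
    (hkT : k * τ ≤ T) :
    normL2 (trigPoly h (U (k * τ)) - trigPoly h (strangIterate γ τ Z n h v g k) :
        C(Torus d, ℂ)) ≤
      ENNReal.ofReal (τ ^ 2 * strangConst (splittingBound γ α v) * (k * τ)) *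
        ⨆ s ∈ Set.Icc (0 : ℝ) (k * τ), ENNReal.ofReal (graphNorm γ h (U s)) := by
  have hU0 : WithLp.toLp 2 (U 0) = sample Z n h g := by
    rw [hU.initial]
    rfl
  rw [hh.normL2_trigPoly_sub hn, toLp_strangIterate, ← hU0]
  rcases Nat.eq_zero_or_pos k with rfl | hk
  · simp
  · have hk' : (0 : ℝ) < k := by exact_mod_cast hk
    have hC := strangConst_pos (splittingBound_nonneg hγ α v)
    refine enorm_le_ofReal_mul_iSup (by positivity) fun M hM hMs => ?_
    have hsub : Set.Icc 0 (k * τ) ⊆ Set.Icc 0 T := Set.Icc_subset_Icc_right hkT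
    refine ((isSplitting_kineticOp_potentialOp hγ hα hh hn hv).norm_sub_strangFlow_pow_le
      hτ.le k (y := fun s => WithLp.toLp 2 (U s)) (M := M)
      (fun s hs => (hU.hasDerivWithinAt hγ (hsub hs)).mono hsub) fun s hs => ?_).trans
      (le_of_eq (by ring))
    rw [← graphNorm_eq]
    exact (ENNReal.ofReal_le_ofReal_iff hM).1 (hMs s hs)

end Errors

end TDSE

theorem theorem4p1 (d : ℕ) (γ : ℝ) (hγ : 0 < γ) (α : ℝ) (hα : 9 / 2 ≤ α)
    (v : C(TDSE.Torus d, ℝ)) (hv : TDSE.IsKorobov α (fun x => (v x : ℂ))) :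
    ∃ C₂ : ℝ, 0 ≤ C₂ ∧
      ∀ (r : ℕ) (Z : Matrix (Fin d) (Fin r) ℤ) (n : Fin r → ℕ), TDSE.IsCanonical Z n →
      ∀ h : TDSE.MultiIndex n → Fin d → ℤ, TDSE.IsMinimalAntiAliasing Z n h →
      ∀ (β : ℝ) (g : C(TDSE.Torus d, ℂ)), 2 ≤ β → TDSE.IsKorobov β g →
      ∀ (T : ℝ) (u : ℝ → C(TDSE.Torus d, ℂ)), TDSE.IsSolution γ T v g u →
      ∀ U : ℝ → TDSE.MultiIndex n → ℂ, TDSE.IsSemidiscreteSolution γ T Z n h v g U →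
      ∀ (Δt : ℝ) (k : ℕ) (t : ℝ), 0 < Δt → t = k * Δt → t ≤ T →
        TDSE.normL2 (u t - TDSE.trigPoly h (TDSE.strangIterate γ Δt Z n h v g k)) ≤
          TDSE.normL2 (u t - TDSE.interp Z n h (u t)) +
            TDSE.normL2 (TDSE.interp Z n h (u t) - TDSE.trigPoly h (U t)) +
            TDSE.normL2 (TDSE.trigPoly h (U t) -
              TDSE.trigPoly h (TDSE.strangIterate γ Δt Z n h v g k)) ∧
        TDSE.normL2 (u t - TDSE.interp Z n h (u t)) +
            TDSE.normL2 (TDSE.interp Z n h (u t) - TDSE.trigPoly h (U t)) +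
            TDSE.normL2 (TDSE.trigPoly h (U t) -
              TDSE.trigPoly h (TDSE.strangIterate γ Δt Z n h v g k)) ≤
          2 * TDSE.tailSum (Set.range h) (u t) +
            ENNReal.ofReal (4 * Real.pi ^ 2 * (t * γ / 2)) *
              (⨆ t' ∈ Set.Icc (0 : ℝ) t, TDSE.weightedTailSum (Set.range h) (u t')) +
            ENNReal.ofReal (Δt ^ 2 * C₂ * t) *
              (⨆ t' ∈ Set.Icc (0 : ℝ) t,
                ENNReal.ofReal (TDSE.graphNorm γ h (U t'))) := by
  have hs : Summable (TDSE.torusFourierCoeff (TDSE.toComplex v)) :=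
    TDSE.summable_of_korobov hα hv
  refine ⟨TDSE.strangConst (TDSE.splittingBound γ α v),
    (TDSE.strangConst_pos (TDSE.splittingBound_nonneg hγ α v)).le, ?_⟩
  intro r Z n hZ h hh β g _ _ T u hu U hU Δt k t hΔt ht htT
  subst ht
  have ht0 : 0 ≤ k * Δt := by positivity
  refine ⟨TDSE.normL2_sub_le_add_add _ _ _ _, add_le_add (add_le_add ?_ ?_) ?_⟩
  · exact hh.normL2_sub_interp_le hZ.moduli_pos (u (k * Δt))
  · exact TDSE.normL2_interp_sub_trigPoly_le hγ hh hZ.moduli_pos hs hu hU ht0 htT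
  · exact TDSE.normL2_trigPoly_sub_strangIterate_le hγ hα hh hZ.moduli_pos hv hU hΔt k htT
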